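/- Let $n\ge 1$ and $\sigma>0$. For $f\in L^1(\mathbb R^n)$ write $f\in L^{1,1}$ if $\int_{\mathbb R^n}(1+|x|)|f(x)|\,dx<\infty$, and put $P_f=\int_{\mathbb R^n} f(x)\,dx$, $M_f=\int_{\mathbb R^n} x f(x)\,dx$. Let $u_0,u_1,\theta_0\in L^2(\mathbb R^n)\cap L^{1,1}(\mathbb R^n)$ (complex-valued, in particular possibly real-valued), and let $(u,\theta)$ be a solution of the Cauchy problem $$u_{tt}+\Delta^2u+\Delta\theta=0,\qquad \theta_t-\Delta\theta+\sigma\theta-\Delta u_t=0,\qquad (u,u_t,\theta)(0,\cdot)=(u_0,u_1,\theta_0)$$ on $[0,\infty)\times\mathbb R^n$ in the class $u\in C([0,\infty);L^2)\cap C^1([0,\infty);H^{-2})$, $\theta\in C([0,\infty);H^{-2})$, where the equations hold, at every time, in the sense of tempered distributions in $x$. For $t>0$ define $$J_0=\mathcal F^{-1}_{\xi\to x}\Big(\frac{\sin(|\xi|^2t)}{|\xi|^2}e^{-\frac{|\xi|^4t}{2\sigma}}\Big),\qquad J_1=\mathcal F^{-1}_{\xi\to x}\Big(\cos(|\xi|^2t)e^{-\frac{|\xi|^4t}{2\sigma}}\Big),$$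 $$H=\frac{t}{8\sigma^2}\mathcal F^{-1}_{\xi\to x}\Big(\big((2\sigma+1)\cos(|\xi|^2t)+4\sin(|\xi|^2t)\big)|\xi|^4e^{-\frac{|\xi|^4t}{2\sigma}}\Big),$$ where $(\mathcal F^{-1}m)(x)=(2\pi)^{-n}\int_{\mathbb R^n}e^{i x\cdot\xi}m(\xi)\,d\xi$, and $$\varphi(t,x)=J_0P_{u_1}-\langle\nabla J_0,M_{u_1}\rangle+H P_{u_1}+J_1P_{u_0}-\sigma^{-1}\Delta J_0\,P_{\theta_0}.$$ Here $\langle a,b\rangle=\sum_i a_ib_i$. Let $B_n(t)=t^{1/4}$ for $n=1$, $B_n(t)=\sqrt{\ln t}$ for $n=2$, and $B_n(t)=t^{\frac14-\frac n8}$ for $n\ge3$. Then $\varphi(t,\cdot)\in L^2$ for every $t>0$, and $$\|u(t,\cdot)-\varphi(t,\cdot)\|_{L^2}=o(B_n(t))\qquad\text{as }t\to\infty.$$ In particular $\|u(t,\cdot)-\varphi(t,\cdot)\|_{L^2}\to0$ as $t\to\infty$ when $n\ge3$. -/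

import Mathlib

open MeasureTheory Filter Topology Asymptotics
open scoped SchwartzMap FourierTransform Laplacian ENNReal

noncomputable section

namespace ThermoPlate

/-- The Euclidean space `ℝⁿ`. -/
abbrev E (n : ℕ) : Type := EuclideanSpace ℝ (Fin n)

/-- The space `L²(ℝⁿ)`. -/
abbrev L2 (n : ℕ) : Type := Lp ℂ 2 (volume : Measure (E n))

/-- Membership in the weighted space `L^{1,1}`: `f ∈ L¹` and `∫ (1 + |x|) |f(x)| dx < ∞`. -/
def MemL11 {n : ℕ} (f : E n → ℂ) : Prop :=
  Integrable f ∧ Integrable (fun x : E n ↦ (1 + ‖x‖) * ‖f x‖)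

/-- The mean `P_f = ∫ f(x) dx`. -/
def meanP {n : ℕ} (f : E n → ℂ) : ℂ := ∫ x, f x

/-- The `i`-th component of the first moment `M_f = ∫ x f(x) dx`. -/
def momentM {n : ℕ} (f : E n → ℂ) (i : Fin n) : ℂ := ∫ x : E n, (x i : ℂ) * f x

/-- Continuity of `w : [0, ∞) → H^s(ℝⁿ)`, where `H^s` is the `L²`-based Sobolev space
(through Bessel potentials: `f ∈ H^s` iff `besselPotential s f ∈ L²`). -/
def ContinuousInSobolev {n : ℕ} (s : ℝ) (w : ℝ → 𝓢'(E n, ℂ)) : Prop :=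
  ∃ W : ℝ → L2 n, ContinuousOn W (Set.Ici 0) ∧
    ∀ t, 0 ≤ t → TemperedDistribution.besselPotential (E n) ℂ s (w t) = (W t : 𝓢'(E n, ℂ))

/-- `w' = z` on `[0, ∞)` (one-sided at `0`) in the sense of tempered distributions in space. -/
def HasTimeDeriv {n : ℕ} (w z : ℝ → 𝓢'(E n, ℂ)) : Prop :=
  ∀ g : 𝓢(E n, ℂ), ∀ t, 0 ≤ t →
    HasDerivWithinAt (fun r ↦ w r g) (z t g) (Set.Ici 0) t

/-- `(u, θ)` solves the Cauchy problem
`u_tt + Δ²u + Δθ = 0`, `θ_t - Δθ + σθ - Δu_t = 0`, `(u, u_t, θ)(0) = (u₀, u₁, θ₀)`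
for data in `L²`, in the class `u ∈ C([0,∞); L²) ∩ C¹([0,∞); H⁻²)`, `θ ∈ C([0,∞); H⁻²)`.
The equations hold in the sense of tempered distributions at every time, and
`v` is the velocity `u_t`. (For `u₀` merely in `L²` the velocity and the temperature take values
in `H⁻²`, since `Δu₀` enters at the same level as `u₁` and `θ₀`.) -/
def IsSolution {n : ℕ} (σ : ℝ) (u₀ u₁ θ₀ : L2 n) (u : ℝ → L2 n) (θ : ℝ → 𝓢'(E n, ℂ)) : Prop :=
  ContinuousOn u (Set.Ici 0) ∧ ContinuousInSobolev (-2) θ ∧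
  ∃ v : ℝ → 𝓢'(E n, ℂ), ContinuousInSobolev (-2) v ∧
    HasTimeDeriv (fun t ↦ (u t : 𝓢'(E n, ℂ))) v ∧
    HasTimeDeriv v (fun t ↦ -(Δ (Δ (u t : 𝓢'(E n, ℂ))) + Δ (θ t))) ∧
    HasTimeDeriv θ (fun t ↦ Δ (θ t) - (σ : ℂ) • θ t + Δ (v t)) ∧
    u 0 = u₀ ∧ v 0 = (u₁ : 𝓢'(E n, ℂ)) ∧ θ 0 = (θ₀ : 𝓢'(E n, ℂ))

/-- The inverse Fourier transform `(2π)⁻ⁿ ∫ exp(i x·ξ) m(|ξ|) dξ` of a radial multiplier, in the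
normalization where `-Δ` has the symbol `|ξ|²` and `f̂(0) = ∫ f`. Mathlib's transform has the kernel
`exp(2πi x·η)`, so that `ξ = 2πη`. -/
def radialInv (n : ℕ) (m : ℝ → ℝ) : E n → ℂ :=
  𝓕⁻ (fun η : E n ↦ ((m (2 * Real.pi * ‖η‖) : ℝ) : ℂ))

/-- `J₀(t, ·)`, with multiplier `sin(|ξ|² t) |ξ|⁻² exp(-|ξ|⁴ t / (2σ))`. -/
def J0 (n : ℕ) (σ t : ℝ) : E n → ℂ :=
  radialInv n fun r ↦ Real.sin (r ^ 2 * t) / r ^ 2 * Real.exp (-(r ^ 4 * t / (2 * σ)))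

/-- `J₁(t, ·)`, with multiplier `cos(|ξ|² t) exp(-|ξ|⁴ t / (2σ))`. -/
def J1 (n : ℕ) (σ t : ℝ) : E n → ℂ :=
  radialInv n fun r ↦ Real.cos (r ^ 2 * t) * Real.exp (-(r ^ 4 * t / (2 * σ)))

/-- The correction term `H(t, ·)`, that is `t / (8σ²)` times the inverse Fourier transform of
`((2σ + 1) cos(|ξ|² t) + 4 sin(|ξ|² t)) |ξ|⁴ exp(-|ξ|⁴ t / (2σ))`. -/
def H (n : ℕ) (σ t : ℝ) (x : E n) : ℂ :=
  ((t / (8 * σ ^ 2) : ℝ) : ℂ) * radialInv n (fun r ↦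
    ((2 * σ + 1) * Real.cos (r ^ 2 * t) + 4 * Real.sin (r ^ 2 * t)) * r ^ 4 *
      Real.exp (-(r ^ 4 * t / (2 * σ)))) x

/-- `⟨∇F(x), M⟩ = ∑ᵢ ∂ᵢF(x) Mᵢ`. -/
def gradPair {n : ℕ} (F : E n → ℂ) (M : Fin n → ℂ) (x : E n) : ℂ :=
  ∑ i, fderiv ℝ F x (EuclideanSpace.single i 1) * M i

/-- The asymptotic profile
`φ = J₀ P_{u₁} - ⟨∇J₀, M_{u₁}⟩ + H P_{u₁} + J₁ P_{u₀} - σ⁻¹ ΔJ₀ P_{θ₀}`.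
The first two terms are the first-order expansion of the convolution of `J₀` and `u₁`,
from `J₀(x - y) = J₀(x) - ⟨y, ∇J₀(x)⟩ + …`. -/
def profile {n : ℕ} (σ : ℝ) (u₀ u₁ θ₀ : E n → ℂ) (t : ℝ) (x : E n) : ℂ :=
  J0 n σ t x * meanP u₁ - gradPair (J0 n σ t) (momentM u₁) x + H n σ t x * meanP u₁
    + J1 n σ t x * meanP u₀ - (σ : ℂ)⁻¹ * (Δ (J0 n σ t)) x * meanP θ₀

/-- The rate `B_n(t)`, for `n ≥ 1`. -/
def B (n : ℕ) (t : ℝ) : ℝ :=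
  if n = 1 then t ^ (1 / 4 : ℝ)
  else if n = 2 then Real.sqrt (Real.log t)
  else t ^ (1 / 4 - (n : ℝ) / 8)

end ThermoPlate

end

/-! With `ρ = |ξ|²` the system becomes a 3×3 linear ODE at each frequency, and the solution is `û(t)
= k₀ û₀ + k₁ û₁ + k₂ θ̂₀` (`fourier_solution`). At low frequency the oscillating modes behave like
`exp((±iρ - ρ²/(2σ)) t)`. A Lyapunov functional (`energy_decay`) and a normal form
(`oscillation_asymptotics`) make this quantitative at all frequencies: `k₁` equals the symbol `Ĵ₀ =
sin(ρt)/ρ · exp(-ρ²t/(2σ))` up to `K exp(-rate·t)`, and `k₀`, `k₂` are themselves of that size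
(`exists_kernel_bound`).

The rate is at least of order `|ξ|⁴` at low frequency and at least a positive constant at high
frequency. Against the bounded transforms of the data, a factor `exp(-c t|ξ|⁴)` costs `O(t^(-n/8))`
in `L²`; against their `L²` norms, the high frequencies cost `O(exp(-ct))`. Both are `o(B_n)`. The
symbols of `J₁`, of `H` and of `ΔJ₀` are also bounded by constants times `exp(-c t|ξ|⁴)`, so these
terms of the profile are errors of the same order and need not be matched with the solution.

What remains is `Ĵ₀ (û₁ - P + i⟨ξ, M⟩)`. The finite first moment makes `û₁` differentiable at `0`,
so for every `δ` the bracket is at most `δ|ξ| + C|ξ|²` with `C` depending on `δ`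
(`exists_fourier_expansion`). The quadratic part is again harmless because `|ξ|²|Ĵ₀| ≤
exp(-ρ²t/(2σ))`. The linear part costs `δ` times the `L²` norm of `|ξ| Ĵ₀`, which is `O(B_n)`
(`exists_leading_bound`). Since `δ` is arbitrary, the difference is `o(B_n)`. -/

namespace ThermoPlate

/-! ### Kernels of the Fourier-side system. -/

open scoped Matrix.Norms.Operator

/-- The generator of the (dual) Fourier-side system at `|ξ|² = ρ`. -/
def genMatrix (σ ρ : ℝ) : Matrix (Fin 3) (Fin 3) ℝ :=
  !![0, -ρ ^ 2, 0; 1, 0, -ρ; 0, ρ, -(ρ + σ)]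

/-- The three solution kernels: `û(t) = k₀ û₀ + k₁ û₁ + k₂ θ̂₀`. -/
noncomputable def kernel (σ t ρ : ℝ) (i : Fin 3) : ℝ :=
  NormedSpace.exp (t • genMatrix σ ρ) i 0

/-- Taylor coefficients of the kernels, without the factorials. -/
def coeff (σ ρ : ℝ) (k : ℕ) (i : Fin 3) : ℝ := (genMatrix σ ρ ^ k) i 0

lemma coeff_zero (σ ρ : ℝ) (i : Fin 3) : coeff σ ρ 0 i = if i = 0 then 1 else 0 := by
  simp [coeff, Matrix.one_apply]

lemma coeff_succ (σ ρ : ℝ) (k : ℕ) :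
    coeff σ ρ (k + 1) 0 = -ρ ^ 2 * coeff σ ρ k 1 ∧
    coeff σ ρ (k + 1) 1 = coeff σ ρ k 0 - ρ * coeff σ ρ k 2 ∧
    coeff σ ρ (k + 1) 2 = ρ * coeff σ ρ k 1 - (ρ + σ) * coeff σ ρ k 2 := by
  simp only [coeff, pow_succ', Matrix.mul_apply, Fin.sum_univ_three]
  generalize genMatrix σ ρ ^ k = X
  refine ⟨?_, ?_, ?_⟩ <;> simp [genMatrix, -mul_eq_mul_right_iff, -mul_eq_mul_left_iff] <;> ring

lemma abs_entry_le_norm (X : Matrix (Fin 3) (Fin 3) ℝ) (i j : Fin 3) : |X i j| ≤ ‖X‖ := by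
  have h : ‖X i j‖₊ ≤ ‖X‖₊ := by
    rw [Matrix.linfty_opNNNorm_def]
    refine le_trans ?_ (Finset.le_sup (f := fun i ↦ ∑ j, ‖X i j‖₊) (Finset.mem_univ i))
    exact Finset.single_le_sum (f := fun j ↦ ‖X i j‖₊) (fun _ _ ↦ zero_le) (Finset.mem_univ j)
  exact_mod_cast h

lemma abs_coeff_le (σ ρ : ℝ) (k : ℕ) (i : Fin 3) :
    |coeff σ ρ k i| ≤ ‖genMatrix σ ρ‖ ^ k :=
  (abs_entry_le_norm _ _ _).trans (norm_pow_le _ _)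

lemma continuous_genMatrix (σ : ℝ) : Continuous (genMatrix σ) := by
  refine continuous_matrix fun i j ↦ ?_
  fin_cases i <;> fin_cases j <;> simp [genMatrix] <;> fun_prop

lemma continuous_coeff (σ : ℝ) (k : ℕ) (i : Fin 3) : Continuous fun ρ ↦ coeff σ ρ k i :=
  (((continuous_genMatrix σ).pow k).matrix_elem i 0)

lemma continuous_kernel (σ t : ℝ) (i : Fin 3) : Continuous fun ρ ↦ kernel σ t ρ i :=
  Continuous.matrix_elem
    ((NormedSpace.exp_continuous).comp ((continuous_genMatrix σ).const_smul t)) i 0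

lemma hasSum_kernel (σ t ρ : ℝ) (i : Fin 3) :
    HasSum (fun k : ℕ ↦ t ^ k / (k.factorial : ℝ) * coeff σ ρ k i) (kernel σ t ρ i) := by
  have h := NormedSpace.exp_series_hasSum_exp' (𝕂 := ℝ) (t • genMatrix σ ρ)
  have h2 := Pi.hasSum.1 (Pi.hasSum.1 h i) 0
  refine h2.congr_fun ?_ |> fun h ↦ h
  intro k
  simp [smul_pow, coeff]
  ring

lemma kernel_at_zero (σ ρ : ℝ) (i : Fin 3) : kernel σ 0 ρ i = if i = 0 then 1 else 0 := by
  simp [kernel, Matrix.one_apply]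

lemma hasDerivAt_kernel (σ t ρ : ℝ) :
    HasDerivAt (fun t ↦ kernel σ t ρ 0) (-ρ ^ 2 * kernel σ t ρ 1) t ∧
    HasDerivAt (fun t ↦ kernel σ t ρ 1) (kernel σ t ρ 0 - ρ * kernel σ t ρ 2) t ∧
    HasDerivAt (fun t ↦ kernel σ t ρ 2) (ρ * kernel σ t ρ 1 - (ρ + σ) * kernel σ t ρ 2) t := by
  have h := hasDerivAt_exp_smul_const' (𝕂 := ℝ) (genMatrix σ ρ) t
  have h2 : ∀ i, HasDerivAt (fun t ↦ kernel σ t ρ i)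
      ((genMatrix σ ρ * NormedSpace.exp (t • genMatrix σ ρ)) i 0) t := fun i ↦
    hasDerivAt_pi.1 (hasDerivAt_pi.1 h i) 0
  refine ⟨?_, ?_, ?_⟩
  · convert h2 0 using 1
    simp [Matrix.mul_apply, Fin.sum_univ_three, genMatrix, kernel]
  · convert h2 1 using 1
    simp [Matrix.mul_apply, Fin.sum_univ_three, genMatrix, kernel]
    ring
  · convert h2 2 using 1
    simp [Matrix.mul_apply, Fin.sum_univ_three, genMatrix, kernel]
    ring

/-! ### Decay and asymptotics of the kernels. -/

/-- Duhamel's bound for a damped scalar equation with an exponentially decaying source. -/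
lemma norm_sub_exp_le_of_forced {f R : ℝ → ℂ} {l : ℂ} {k m K : ℝ} (hK : 0 ≤ K) (hl : l.re = -m)
    (hkm : k < m) (hf : ∀ t, HasDerivAt f (l * f t + R t) t)
    (hR : ∀ t, 0 ≤ t → ‖R t‖ ≤ K * Real.exp (-(k * t))) {t : ℝ} (ht : 0 ≤ t) :
    ‖f t - Complex.exp (l * t) * f 0‖ ≤ K / (m - k) * Real.exp (-(k * t)) := by
  have hE : ∀ s : ℝ, HasDerivAt (fun s : ℝ ↦ Complex.exp (-l * s)) (Complex.exp (-l * s) * -l) s :=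
    fun s ↦ by
      have := ((hasDerivAt_id (s : ℂ)).const_mul (-l)).cexp.comp_ofReal
      simpa using this
  have hn : ∀ s : ℝ, ‖Complex.exp (-l * s)‖ = Real.exp (m * s) := fun s ↦ by
    rw [Complex.norm_exp]; simp [hl]
  have hmk : 0 < m - k := sub_pos.2 hkm
  have hg : ∀ s : ℝ, HasDerivAt (fun s : ℝ ↦ Complex.exp (-l * s) * f s - f 0)
      (Complex.exp (-l * s) * R s) s := fun s ↦ by
    have := ((hE s).mul (hf s)).sub_const (f 0)
    exact this.congr_deriv (by ring)
  have hB : ∀ s : ℝ, HasDerivAt (fun s : ℝ ↦ K / (m - k) * Real.exp ((m - k) * s))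
      (K * Real.exp ((m - k) * s)) s := fun s ↦ by
    have := (((hasDerivAt_id s).const_mul (m - k)).exp).const_mul (K / (m - k))
    exact this.congr_deriv (by simp only [id, mul_one]; field_simp)
  -- The integrating factor removes `l`; the barrier `K/(m-k) · exp((m-k)s)` is an antiderivative of
  -- the bound on the remaining derivative, and it is nonnegative at `s = 0`, where the function
  -- vanishes.
  have key := image_norm_le_of_norm_deriv_right_le_deriv_boundary (a := 0) (b := t)
    (f := fun s : ℝ ↦ Complex.exp (-l * s) * f s - f 0)
    (fun s _ ↦ (hg s).continuousAt.continuousWithinAt)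
    (fun s _ ↦ (hg s).hasDerivWithinAt)
    (B := fun s : ℝ ↦ K / (m - k) * Real.exp ((m - k) * s))
    (B' := fun s : ℝ ↦ K * Real.exp ((m - k) * s))
    (by simp; positivity)
    hB
    (fun s hs ↦ by
      rw [norm_mul, hn]
      calc Real.exp (m * s) * ‖R s‖ ≤ Real.exp (m * s) * (K * Real.exp (-(k * s))) := by
            gcongr; exact hR s hs.1
        _ = K * Real.exp ((m - k) * s) := by
            rw [show (m - k) * s = m * s + -(k * s) by ring, Real.exp_add]; ring)
    (Set.right_mem_Icc.2 ht)
  have hid : f t - Complex.exp (l * t) * f 0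
      = Complex.exp (l * t) * (Complex.exp (-l * t) * f t - f 0) := by
    rw [mul_sub, ← mul_assoc, ← Complex.exp_add]
    simp
  rw [hid, norm_mul, Complex.norm_exp]
  have h3 : (l * (t : ℂ)).re = -m * t := by simp [hl]
  rw [h3]
  calc Real.exp (-m * t) * ‖Complex.exp (-l * t) * f t - f 0‖
      ≤ Real.exp (-m * t) * (K / (m - k) * Real.exp ((m - k) * t)) := by gcongr
    _ = K / (m - k) * Real.exp (-(k * t)) := by
      rw [show -(k * t) = -m * t + (m - k) * t by ring, Real.exp_add]; ring

/-- The decay rate of the kernels. -/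
noncomputable def rate (σ ρ : ℝ) : ℝ := ρ ^ 2 / (64 * (ρ + σ))

/-- Hypocoercivity: the plain energy only dissipates `c`, at rate `2(ρ+σ)c²`. The cross term `-2αbc`
produces damping of `b`, and `-αab` trades half of it for damping of `a`. -/
lemma energy_decay {σ ρ : ℝ} (hσ : 0 < σ) (hρ : 0 < ρ) {a b c : ℝ → ℝ}
    (ha : ∀ t, HasDerivAt a (-ρ * b t) t) (hb : ∀ t, HasDerivAt b (ρ * a t - ρ * c t) t)
    (hc : ∀ t, HasDerivAt c (ρ * b t - (ρ + σ) * c t) t) (h0 : a 0 = 1) (h1 : b 0 = 0)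
    (h2 : c 0 = 0) {t : ℝ} (ht : 0 ≤ t) :
    a t ^ 2 + b t ^ 2 + c t ^ 2 ≤ 4 * Real.exp (-(2 * rate σ ρ * t)) := by
  have hs : 0 < ρ + σ := by positivity
  -- The size of `α` lets `2α(ρ+σ)bc` be absorbed by `αρb²` and `(ρ+σ)c²`, which needs `α(ρ+σ)` of
  -- order `ρ`; `α ≤ 1/8` keeps `Ly` comparable with the energy.
  set α : ℝ := ρ / (8 * (ρ + σ)) with hα
  have hα0 : 0 < α := by positivity
  have hα8 : α ≤ 1 / 8 := by
    rw [hα, div_le_div_iff₀ (by positivity) (by norm_num)]; nlinarith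
  have hαs : α * (ρ + σ) = ρ / 8 := by rw [hα]; field_simp
  have hk : 2 * rate σ ρ = α * ρ / 4 := by rw [hα, rate]; field_simp; norm_num
  set Ly : ℝ → ℝ := fun t ↦ a t ^ 2 + b t ^ 2 + c t ^ 2 - 2 * α * (b t * c t) - α * (a t * b t)
  have hL : ∀ s, HasDerivAt Ly (-2 * (ρ + σ) * c s ^ 2 - α * ρ * b s ^ 2 - α * ρ * a s ^ 2
      + 2 * α * ρ * c s ^ 2 - α * ρ * (a s * c s) + 2 * (α * (ρ + σ)) * (b s * c s)) s := fun s ↦ by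
    have := (((((ha s).pow 2).add ((hb s).pow 2)).add ((hc s).pow 2)).sub
      (((hb s).mul (hc s)).const_mul (2 * α))).sub (((ha s).mul (hb s)).const_mul α)
    exact this.congr_deriv (by push_cast; ring)
  have hcmp : ∀ s, 3 / 4 * (a s ^ 2 + b s ^ 2 + c s ^ 2) ≤ Ly s ∧
      Ly s ≤ 5 / 4 * (a s ^ 2 + b s ^ 2 + c s ^ 2) := fun s ↦ by
    have e1 : |2 * (b s * c s)| ≤ b s ^ 2 + c s ^ 2 := by
      rw [abs_le]; constructor <;> nlinarith [sq_nonneg (b s - c s), sq_nonneg (b s + c s)]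
    have e2 : |a s * b s| ≤ a s ^ 2 + b s ^ 2 := by
      rw [abs_le]; constructor <;>
        nlinarith [sq_nonneg (a s - b s), sq_nonneg (a s + b s), sq_nonneg (a s), sq_nonneg (b s)]
    rw [abs_le] at e1 e2
    have e3 := sq_nonneg (a s)
    have e4 := sq_nonneg (b s)
    have e5 := sq_nonneg (c s)
    simp only [Ly]
    constructor <;> nlinarith
  have hdec : ∀ s, -2 * (ρ + σ) * c s ^ 2 - α * ρ * b s ^ 2 - α * ρ * a s ^ 2
      + 2 * α * ρ * c s ^ 2 - α * ρ * (a s * c s) + 2 * (α * (ρ + σ)) * (b s * c s)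
      ≤ -(2 * rate σ ρ) * Ly s := fun s ↦ by
    have hE := (hcmp s).2
    have hαρ : 0 < α * ρ := by positivity
    have h1 : -(2 * rate σ ρ) * Ly s
        ≥ -(α * ρ / 4) * (5 / 4 * (a s ^ 2 + b s ^ 2 + c s ^ 2)) := by
      rw [hk]; nlinarith
    have h2 : -(α * ρ) * (a s * c s) ≤ α * ρ * (a s ^ 2 / 2 + c s ^ 2 / 2) := by
      nlinarith [sq_nonneg (a s + c s)]
    have h3 : 2 * (α * (ρ + σ)) * (b s * c s) ≤ α * ρ / 2 * b s ^ 2 + (ρ + σ) / 4 * c s ^ 2 := by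
      have hp : α * ρ = 8 * α ^ 2 * (ρ + σ) := by
        rw [show 8 * α ^ 2 * (ρ + σ) = 8 * α * (α * (ρ + σ)) by ring, hαs]; ring
      rw [hp]
      nlinarith [mul_nonneg hs.le (sq_nonneg (2 * α * b s - c s / 2))]
    have h4 : α * ρ * c s ^ 2 ≤ (ρ + σ) / 8 * c s ^ 2 := by
      have : α * ρ ≤ (ρ + σ) / 8 := by nlinarith
      gcongr
    nlinarith [sq_nonneg (a s), sq_nonneg (b s), sq_nonneg (c s),
      mul_nonneg hαρ.le (sq_nonneg (a s)), mul_nonneg hαρ.le (sq_nonneg (b s)),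
      mul_nonneg hs.le (sq_nonneg (c s))]
  have hmono : AntitoneOn (fun s ↦ Real.exp (2 * rate σ ρ * s) * Ly s) (Set.Ici 0) := by
    have hd : ∀ s, HasDerivAt (fun s ↦ Real.exp (2 * rate σ ρ * s) * Ly s) _ s := fun s ↦
      (((hasDerivAt_id s).const_mul (2 * rate σ ρ)).exp).mul (hL s)
    refine antitoneOn_of_deriv_nonpos (convex_Ici 0)
      (fun s _ ↦ (hd s).continuousAt.continuousWithinAt)
      (fun s _ ↦ (hd s).differentiableAt.differentiableWithinAt) (fun s _ ↦ ?_)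
    rw [(hd s).deriv]
    have := hdec s
    have hp := Real.exp_pos (2 * rate σ ρ * s)
    simp only [id, mul_one]
    nlinarith
  have h := hmono (Set.mem_Ici.2 le_rfl) (Set.mem_Ici.2 ht) ht
  have hL0 : Ly 0 = 1 := by simp [Ly, h0, h1, h2]
  simp only [mul_zero, Real.exp_zero, hL0, one_mul] at h
  have h5 : Ly t ≤ Real.exp (-(2 * rate σ ρ * t)) := by
    rw [Real.exp_neg]
    rw [← one_div, le_div_iff₀ (Real.exp_pos _), mul_comm]; exact h
  have := (hcmp t).1
  have hp := Real.exp_pos (-(2 * rate σ ρ * t))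
  linarith

end ThermoPlate

namespace ThermoPlate

open scoped ComplexConjugate

lemma HasDerivAt.conj_ofReal_var {f : ℝ → ℂ} {f' : ℂ} {t : ℝ} (h : HasDerivAt f f' t) :
    HasDerivAt (fun s ↦ conj (f s)) (conj f') t := by
  simpa using h.star

lemma rate_pos {σ ρ : ℝ} (hσ : 0 < σ) (hρ : 0 < ρ) : 0 < rate σ ρ := by
  unfold rate; positivity

/-- The factor `1/2`, here and in `rate_le_relaxation`, leaves `m - k ≥ m/2` in Duhamel's bound, so
that no constant degenerates. -/
lemma rate_le_damping {σ ρ : ℝ} (hσ : 0 < σ) (hρ : 0 < ρ) :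
    rate σ ρ ≤ ρ ^ 2 / (2 * σ) / 2 := by
  rw [rate, div_div, div_le_div_iff₀ (by positivity) (by positivity)]
  nlinarith [mul_pos (pow_pos hρ 2) hσ, mul_pos (pow_pos hρ 2) hρ]

lemma rate_le_relaxation {σ ρ : ℝ} (hσ : 0 < σ) (hρ : 0 < ρ) :
    rate σ ρ ≤ (ρ + σ) / 2 := by
  rw [rate, div_le_div_iff₀ (by positivity) (by positivity)]
  nlinarith [mul_pos hρ hσ, sq_nonneg ρ, sq_nonneg σ]

/-- The fast variable `c` is slaved to `b` with ratio `δ = ρ/(ρ+σ)`. Eliminating it leaves a weakly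
damped oscillator, whose conjugate coupling is removed by a near-identity change of variable. All
errors carry a factor `δ`, which pays for the later division by `ρ`. -/
lemma oscillation_asymptotics {σ ρ : ℝ} (hσ : 0 < σ) (hρ : 0 < ρ) {a b c : ℝ → ℝ}
    (ha : ∀ t, HasDerivAt a (-ρ * b t) t) (hb : ∀ t, HasDerivAt b (ρ * a t - ρ * c t) t)
    (hc : ∀ t, HasDerivAt c (ρ * b t - (ρ + σ) * c t) t) (h0 : a 0 = 1) (h1 : b 0 = 0)
    (h2 : c 0 = 0) {t : ℝ} (ht : 0 ≤ t) :
    |a t| ≤ 2 * Real.exp (-(rate σ ρ * t)) ∧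
    |c t| ≤ 4 * (ρ / (ρ + σ)) * Real.exp (-(rate σ ρ * t)) ∧
    |b t - Real.sin (ρ * t) * Real.exp (-(ρ ^ 2 / (2 * σ) * t))| ≤
      100 * (ρ / (ρ + σ)) * Real.exp (-(rate σ ρ * t)) := by
  have hs : 0 < ρ + σ := by positivity
  set k := rate σ ρ with hk
  have hk0 : 0 < k := rate_pos hσ hρ
  have hkν : k ≤ ρ ^ 2 / (2 * σ) / 2 := rate_le_damping hσ hρ
  have hks : k ≤ (ρ + σ) / 2 := rate_le_relaxation hσ hρ
  have hen : ∀ s, 0 ≤ s → |a s| ≤ 2 * Real.exp (-(k * s)) ∧ |b s| ≤ 2 * Real.exp (-(k * s)) := by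
    intro s hs
    have h := energy_decay hσ hρ ha hb hc h0 h1 h2 hs
    have he : 4 * Real.exp (-(2 * k * s)) = (2 * Real.exp (-(k * s))) ^ 2 := by
      rw [mul_pow, ← Real.exp_nat_mul]; congr 2 <;> (push_cast; ring)
    rw [he] at h
    constructor <;> apply abs_le_of_sq_le_sq _ (by positivity) <;>
      nlinarith [sq_nonneg (a s), sq_nonneg (b s), sq_nonneg (c s)]
  set δ := ρ / (ρ + σ) with hδ
  have hδ0 : 0 < δ := by positivity
  have hδ1 : δ ≤ 1 := by rw [hδ, div_le_one hs]; linarith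
  have hδs : δ * (ρ + σ) = ρ := by rw [hδ]; field_simp
  have hcb : ∀ s, 0 ≤ s → |c s| ≤ 4 * δ * Real.exp (-(k * s)) := by
    intro s hs'
    have h := norm_sub_exp_le_of_forced (f := fun t ↦ (c t : ℂ)) (R := fun t ↦ ((ρ * b t : ℝ) : ℂ))
      (l := ((-(ρ + σ) : ℝ) : ℂ)) (k := k) (m := ρ + σ) (K := 2 * ρ) (by positivity) (by simp)
      (by linarith)
      (fun t ↦ by
        refine (hc t).ofReal_comp.congr_deriv ?_
        push_cast; ring)
      (fun t ht ↦ by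
        rw [Complex.norm_real, Real.norm_eq_abs, abs_mul, abs_of_pos hρ]
        have := (hen t ht).2
        nlinarith) hs'
    simp only [h2, Complex.ofReal_zero, mul_zero, sub_zero, Complex.norm_real,
      Real.norm_eq_abs] at h
    refine h.trans ?_
    gcongr
    rw [div_le_iff₀ (by linarith)]
    nlinarith
  refine ⟨(hen t ht).1, hcb t ht, ?_⟩
  -- the normal form variable
  set q : ℝ → ℝ := fun s ↦ b s - δ * c s
  set ν : ℝ := δ * ρ / 2 with hν
  set ν₀ : ℝ := ρ ^ 2 / (2 * σ) with hν₀
  set y : ℝ → ℂ := fun s ↦ (a s : ℂ) + Complex.I * (q s : ℂ) with hy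
  -- `γ` solves `ν = 2iργ`: `y` and its conjugate rotate at opposite frequencies, so adding `γ ·
  -- conj y` cancels the non-resonant term `ν · conj y` and leaves errors of second order in `δ`.
  set γ : ℂ := -Complex.I * (δ / 4 : ℝ) with hγ
  set Y : ℝ → ℂ := fun s ↦ y s + γ * conj (y s) with hY
  set S : ℝ → ℂ := fun s ↦ -(δ * ρ : ℝ) * (1 + Complex.I * δ) * (c s : ℂ) with hS
  -- The reduced system has damping `ν = ρ²/(2(ρ+σ))`, the profile has `ν₀ = ρ²/(2σ)`; the
  -- discrepancy is `δν₀` and joins the forcing `R`.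
  have hνν : ν₀ - ν = δ * (ρ ^ 2 / (2 * σ)) := by
    have hδe : δ = ρ / (ρ + σ) := hδ
    rw [hν₀, hν, hδe]; field_simp; ring
  have hy' : ∀ s, HasDerivAt y ((Complex.I * ρ - ν) * y s + ν * conj (y s) + S s) s := fun s ↦ by
    -- The `c` terms cancel in `q'` because `δ(ρ+σ) = ρ`.
    have hq : HasDerivAt q (ρ * a s - δ * ρ * b s) s :=
      ((hb s).sub ((hc s).const_mul δ)).congr_deriv (by linear_combination c s * hδs)
    refine ((ha s).ofReal_comp.add (hq.ofReal_comp.const_mul Complex.I)).congr_deriv ?_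
    simp only [hy, hS, hν, q, map_add, map_mul, Complex.conj_ofReal, Complex.conj_I]
    push_cast
    ring_nf
    simp only [Complex.I_sq]
    ring
  have hyn : ∀ s, 0 ≤ s → ‖y s‖ ≤ 8 * Real.exp (-(k * s)) := fun s hs ↦ by
    have h1 := (hen s hs).1
    have h2 := (hen s hs).2
    have h3 := hcb s hs
    have h4 : |q s| ≤ 6 * Real.exp (-(k * s)) := by
      calc |q s| ≤ |b s| + |δ * c s| := abs_sub _ _
        _ ≤ 2 * Real.exp (-(k * s)) + 1 * (4 * 1 * Real.exp (-(k * s))) := by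
          rw [abs_mul, abs_of_pos hδ0]
          gcongr
          exact h3.trans (by gcongr)
        _ = _ := by ring
    calc ‖y s‖ ≤ ‖(a s : ℂ)‖ + ‖Complex.I * (q s : ℂ)‖ := norm_add_le _ _
      _ = |a s| + |q s| := by simp
      _ ≤ _ := by linarith
  have hγn : ‖γ‖ = δ / 4 := by
    rw [hγ, norm_mul, Complex.norm_real, Real.norm_eq_abs, abs_of_pos (by positivity)]; simp
  have hYn : ∀ s, 0 ≤ s → ‖Y s‖ ≤ 10 * Real.exp (-(k * s)) := fun s hs ↦ by
    have h := hyn s hs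
    calc ‖Y s‖ ≤ ‖y s‖ + ‖γ * conj (y s)‖ := norm_add_le _ _
      _ = (1 + δ / 4) * ‖y s‖ := by rw [norm_mul, RCLike.norm_conj, hγn]; ring
      _ ≤ (1 + 1 / 4) * (8 * Real.exp (-(k * s))) := by gcongr
      _ = _ := by ring
  have hSn : ∀ s, 0 ≤ s → ‖S s‖ ≤ 8 * δ ^ 2 * ρ * Real.exp (-(k * s)) := fun s hs ↦ by
    have h3 := hcb s hs
    have h5 : ‖(1 + Complex.I * δ : ℂ)‖ ≤ 2 := by
      refine (norm_add_le _ _).trans ?_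
      simp [abs_of_pos hδ0]; linarith
    calc ‖S s‖ = δ * ρ * ‖(1 + Complex.I * δ : ℂ)‖ * |c s| := by
          rw [hS]; simp [abs_of_pos hδ0, abs_of_pos hρ]
      _ ≤ δ * ρ * 2 * (4 * δ * Real.exp (-(k * s))) := by gcongr
      _ = _ := by ring
  set R : ℝ → ℂ := fun s ↦ S s + γ * ν * y s + γ * conj (S s) + ((ν₀ - ν : ℝ) : ℂ) * Y s with hR
  set K : ℝ := 12 * δ ^ 2 * ρ + δ * (ρ ^ 2 / (2 * σ)) * 10 with hK
  have hRn : ∀ s, 0 ≤ s → ‖R s‖ ≤ K * Real.exp (-(k * s)) := fun s hs ↦ by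
    have h1 := hyn s hs
    have h2 := hYn s hs
    have h3 := hSn s hs
    have e := Real.exp_pos (-(k * s))
    calc ‖R s‖ ≤ ‖S s‖ + ‖γ * ν * y s‖ + ‖γ * conj (S s)‖ + ‖((ν₀ - ν : ℝ) : ℂ) * Y s‖ :=
          norm_add₄_le
      _ = (1 + δ / 4) * ‖S s‖ + δ / 4 * (δ * ρ / 2) * ‖y s‖ + δ * (ρ ^ 2 / (2 * σ)) * ‖Y s‖ := by
          rw [norm_mul (γ * ν), norm_mul γ, norm_mul γ, norm_mul _ (Y s), hγn, RCLike.norm_conj,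
            Complex.norm_real, Complex.norm_real, Real.norm_eq_abs, Real.norm_eq_abs, hνν, abs_of_pos (by positivity),
            abs_of_pos (show 0 < δ * (ρ ^ 2 / (2 * σ)) by positivity)]
          ring
      _ ≤ (1 + 1 / 4) * (8 * δ ^ 2 * ρ * Real.exp (-(k * s)))
          + δ / 4 * (δ * ρ / 2) * (8 * Real.exp (-(k * s)))
          + δ * (ρ ^ 2 / (2 * σ)) * (10 * Real.exp (-(k * s))) := by gcongr
      _ = (11 * δ ^ 2 * ρ + δ * (ρ ^ 2 / (2 * σ)) * 10) * Real.exp (-(k * s)) := by ring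
      _ ≤ _ := by
        gcongr; nlinarith [mul_pos (pow_pos hδ0 2) hρ]
  set l : ℂ := Complex.I * ρ - ν₀ with hl
  have hY' : ∀ s, HasDerivAt Y (l * Y s + R s) s := fun s ↦ by
    refine ((hy' s).add ((HasDerivAt.conj_ofReal_var (hy' s)).const_mul γ)).congr_deriv ?_
    have hγν : (ν : ℂ) = 2 * Complex.I * ρ * γ := by
      rw [hγ, hν]; push_cast; ring_nf; simp only [Complex.I_sq]; ring
    have hconj : conj (S s + (Complex.I * ρ - ν) * y s + ν * conj (y s))
        = conj (S s) + (-Complex.I * ρ - ν) * conj (y s) + ν * y s := by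
      simp
    rw [show (Complex.I * ρ - ν) * y s + ν * conj (y s) + S s
      = S s + (Complex.I * ρ - ν) * y s + ν * conj (y s) by ring, hconj]
    simp only [hR, hl, hY]
    push_cast
    linear_combination (conj (y s)) * hγν
  -- The weak damping `ν₀` sits in the denominator, but `K` consists of `δ²ρ` and `δν₀`, and `δρ ≤
  -- 2ν₀`; one power of `δ` survives.
  have hKb : K / (ν₀ - k) ≤ 70 * δ := by
    rw [div_le_iff₀ (by have : 0 < ν₀ := by positivity
                        linarith)]
    have h6 : δ * ρ ≤ ρ ^ 2 / (2 * σ) * 2 := by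
      have : δ * σ ≤ ρ := by nlinarith
      rw [show ρ ^ 2 / (2 * σ) * 2 = ρ ^ 2 / σ by field_simp, le_div_iff₀ hσ]; nlinarith
    have h7 : 70 * δ * (ν₀ / 2) ≤ 70 * δ * (ν₀ - k) := by gcongr; linarith
    refine le_trans ?_ h7
    rw [hK, hν₀]
    nlinarith [mul_le_mul_of_nonneg_left h6 hδ0.le]
  have key := norm_sub_exp_le_of_forced (f := Y) (R := R) (l := l) (k := k) (m := ν₀) (K := K)
    (by positivity) (by simp [hl]) (by have : 0 < ν₀ := by positivity
                                       linarith) hY' hRn ht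
  have hy0 : y 0 = 1 := by simp [hy, q, h0, h1, h2]
  have hY0 : Y 0 = 1 + γ := by simp [hY, hy0]
  have hen0 : ‖Complex.exp (l * t)‖ ≤ Real.exp (-(k * t)) := by
    rw [Complex.norm_exp]
    have : (l * (t : ℂ)).re = -(ν₀ * t) := by simp [hl]
    rw [this]
    gcongr
    have : 0 < ν₀ := by positivity
    linarith
  have hfin : ‖y t - Complex.exp (l * t)‖ ≤ 73 * δ * Real.exp (-(k * t)) := by
    have hid : y t - Complex.exp (l * t) = (Y t - Complex.exp (l * t) * Y 0)
        + γ * Complex.exp (l * t) - γ * conj (y t) := by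
      rw [hY0]; simp only [hY]; ring
    rw [hid]
    calc _ ≤ ‖Y t - Complex.exp (l * t) * Y 0‖ + ‖γ * Complex.exp (l * t)‖ + ‖γ * conj (y t)‖ :=
          (norm_sub_le _ _).trans (by gcongr; exact norm_add_le _ _)
      _ ≤ 70 * δ * Real.exp (-(k * t)) + δ / 4 * Real.exp (-(k * t))
          + δ / 4 * (8 * Real.exp (-(k * t))) := by
        rw [norm_mul γ, norm_mul γ, RCLike.norm_conj, hγn]
        have := hyn t ht
        gcongr
        exact key.trans (by gcongr)
      _ = (72 + 1 / 4) * δ * Real.exp (-(k * t)) := by ring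
      _ ≤ _ := by gcongr; norm_num
  have him : (y t - Complex.exp (l * t)).im = q t - Real.sin (ρ * t) * Real.exp (-(ν₀ * t)) := by
    have : l * (t : ℂ) = ((-(ν₀ * t) : ℝ) : ℂ) + ((ρ * t : ℝ) : ℂ) * Complex.I := by
      rw [hl]; push_cast; ring
    rw [this, Complex.exp_add, ← Complex.ofReal_exp, Complex.sub_im, Complex.im_ofReal_mul,
      Complex.exp_ofReal_mul_I_im]
    simp [hy]
    ring
  have h8 := (Complex.abs_im_le_norm _).trans hfin
  rw [him] at h8
  have h9 := hcb t ht
  calc |b t - Real.sin (ρ * t) * Real.exp (-(ν₀ * t))|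
      = |(q t - Real.sin (ρ * t) * Real.exp (-(ν₀ * t))) + δ * c t| := by simp only [q]; ring_nf
    _ ≤ 73 * δ * Real.exp (-(k * t)) + δ * (4 * 1 * Real.exp (-(k * t))) := by
      refine (abs_add_le _ _).trans ?_
      rw [abs_mul δ, abs_of_pos hδ0]
      gcongr
      exact h9.trans (by gcongr)
    _ = 77 * δ * Real.exp (-(k * t)) := by ring
    _ ≤ _ := by gcongr; norm_num

/-- All kernels agree with those of the profile up to a bounded, uniformly decaying multiplier. -/
lemma exists_kernel_bound {σ : ℝ} (hσ : 0 < σ) : ∃ K : ℝ, 0 < K ∧ ∀ ρ t : ℝ, 0 < ρ → 0 ≤ t →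
    |kernel σ t ρ 0| ≤ K * Real.exp (-(rate σ ρ * t)) ∧
    |kernel σ t ρ 2| ≤ K * Real.exp (-(rate σ ρ * t)) ∧
    |kernel σ t ρ 1 - Real.sin (ρ * t) / ρ * Real.exp (-(ρ ^ 2 * t / (2 * σ)))| ≤
      K * Real.exp (-(rate σ ρ * t)) := by
  -- `a = k₀`, `b = ρk₁`, `c = ρk₂` solve the symmetrized system. Dividing by `ρ` turns the error
  -- `100δ` into `100/(ρ+σ) ≤ 100/σ`; the `2` comes from the bound on `a`.
  refine ⟨2 + 100 / σ, by positivity, fun ρ t hρ ht ↦ ?_⟩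
  have h := oscillation_asymptotics hσ hρ (a := fun t ↦ kernel σ t ρ 0)
    (b := fun t ↦ ρ * kernel σ t ρ 1) (c := fun t ↦ ρ * kernel σ t ρ 2)
    (fun t ↦ (hasDerivAt_kernel σ t ρ).1.congr_deriv (by ring))
    (fun t ↦ ((hasDerivAt_kernel σ t ρ).2.1.const_mul ρ).congr_deriv (by ring))
    (fun t ↦ ((hasDerivAt_kernel σ t ρ).2.2.const_mul ρ).congr_deriv (by ring))
    (by simp [kernel_at_zero]) (by simp [kernel_at_zero]) (by simp [kernel_at_zero]) ht
  obtain ⟨ha, hc, hb⟩ := h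
  have e := Real.exp_pos (-(rate σ ρ * t))
  have hs : 1 / (ρ + σ) ≤ 1 / σ := by gcongr; linarith
  have hσ' : 0 < 1 / σ := by positivity
  have hK : 100 / σ = 100 * (1 / σ) := by ring
  refine ⟨ha.trans ?_, ?_, ?_⟩
  · gcongr; rw [hK]; linarith
  · have : |kernel σ t ρ 2| = |ρ * kernel σ t ρ 2| / ρ := by
      rw [abs_mul, abs_of_pos hρ]; field_simp
    rw [this, div_le_iff₀ hρ]
    refine hc.trans ?_
    calc _ = 4 * (1 / (ρ + σ)) * Real.exp (-(rate σ ρ * t)) * ρ := by ring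
      _ ≤ _ := by gcongr; rw [hK]; linarith
  · have : |kernel σ t ρ 1 - Real.sin (ρ * t) / ρ * Real.exp (-(ρ ^ 2 * t / (2 * σ)))|
      = |ρ * kernel σ t ρ 1 - Real.sin (ρ * t) * Real.exp (-(ρ ^ 2 / (2 * σ) * t))| / ρ := by
      rw [eq_div_iff hρ.ne', ← abs_of_pos hρ, ← abs_mul, abs_of_pos hρ]
      congr 1
      rw [show ρ ^ 2 / (2 * σ) * t = ρ ^ 2 * t / (2 * σ) by ring]
      field_simp
    rw [this, div_le_iff₀ hρ]
    refine hb.trans ?_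
    calc _ = 100 * (1 / (ρ + σ)) * Real.exp (-(rate σ ρ * t)) * ρ := by ring
      _ ≤ _ := by gcongr; rw [hK]; linarith

end ThermoPlate

/-! ### The solution formula in Fourier space. -/

namespace ThermoPlate

/-- Taylor's estimate for a chain of functions, each the derivative of the preceding one. -/
lemma norm_sub_taylor_le {f : ℕ → ℝ → ℂ} {T C M : ℝ}
    (hf : ∀ k t, 0 ≤ t → HasDerivWithinAt (f k) (f (k + 1) t) (Set.Ici 0) t)
    (hb : ∀ k t, 0 ≤ t → t ≤ T → ‖f k t‖ ≤ C * M ^ k) (n : ℕ) :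
    ∀ k t, 0 ≤ t → t ≤ T →
      ‖f k t - ∑ j ∈ Finset.range n, (t ^ j / (j.factorial : ℝ) : ℝ) * f (k + j) 0‖ ≤
        C * M ^ (k + n) * (t ^ n / (n.factorial : ℝ)) := by
  induction n with
  | zero => intro k t h0 hT; simpa using hb k t h0 hT
  | succ n ih =>
    intro k t h0 hT
    have hpow : ∀ (j : ℕ) (s : ℝ), HasDerivAt (fun s : ℝ ↦ s ^ (j + 1) / ((j + 1).factorial : ℝ))
        (s ^ j / (j.factorial : ℝ)) s := fun j s ↦ by
      refine ((hasDerivAt_pow (j + 1) s).div_const _).congr_deriv ?_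
      rw [Nat.factorial_succ]
      push_cast
      field_simp
    have hsum : ∀ s : ℝ, HasDerivAt
        (fun s : ℝ ↦ ∑ j ∈ Finset.range (n + 1), (s ^ j / (j.factorial : ℝ) : ℝ) * f (k + j) 0)
        (∑ j ∈ Finset.range n, (s ^ j / (j.factorial : ℝ) : ℝ) * f (k + 1 + j) 0) s := fun s ↦ by
      simp_rw [Finset.sum_range_succ' _ n]
      simp only [pow_zero, Nat.factorial_zero]
      refine HasDerivAt.add_const _ (HasDerivAt.fun_sum fun j _ ↦ ?_)
      rw [show k + 1 + j = k + (j + 1) by ring]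
      exact ((hpow j s).ofReal_comp).mul_const _
    -- The derivative of the order `n + 1` remainder of `f k` is the order `n` remainder of `f (k +
    -- 1)`, which is why the induction hypothesis ranges over all `k`.
    refine image_norm_le_of_norm_deriv_right_le_deriv_boundary (a := 0) (b := t)
      (f := fun t ↦ f k t - ∑ j ∈ Finset.range (n + 1), (t ^ j / (j.factorial : ℝ) : ℝ) * f (k + j) 0)
      (f' := fun t ↦ f (k + 1) t
        - ∑ j ∈ Finset.range n, (t ^ j / (j.factorial : ℝ) : ℝ) * f (k + 1 + j) 0)
      (B := fun t ↦ C * M ^ (k + (n + 1)) * (t ^ (n + 1) / ((n + 1).factorial : ℝ)))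
      (B' := fun t ↦ C * M ^ (k + (n + 1)) * (t ^ n / (n.factorial : ℝ)))
      ?_ ?_ ?_ ?_ ?_ (Set.right_mem_Icc.2 h0)
    · intro s hs
      exact (((hf k s hs.1).continuousWithinAt).mono Set.Icc_subset_Ici_self).sub
        (hsum s).continuousAt.continuousWithinAt
    · intro s hs
      exact ((hf k s hs.1).mono (Set.Ici_subset_Ici.2 hs.1)).sub (hsum s).hasDerivWithinAt
    · simp [Finset.sum_range_succ']
    · intro s; exact (hpow n s).const_mul _
    · intro s hs
      have := ih (k + 1) s hs.1 (hs.2.le.trans hT)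
      rwa [show k + 1 + n = k + (n + 1) by ring] at this

lemma tendsto_taylor {f : ℕ → ℝ → ℂ} {T C M : ℝ}
    (hf : ∀ k t, 0 ≤ t → HasDerivWithinAt (f k) (f (k + 1) t) (Set.Ici 0) t)
    (hb : ∀ k t, 0 ≤ t → t ≤ T → ‖f k t‖ ≤ C * M ^ k) (hT : 0 ≤ T) :
    Tendsto (fun n ↦ ∑ j ∈ Finset.range n, (T ^ j / (j.factorial : ℝ) : ℝ) * f j 0) atTop
      (𝓝 (f 0 T)) := by
  rw [tendsto_iff_norm_sub_tendsto_zero]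
  have h0 := ((FloorSemiring.tendsto_pow_div_factorial_atTop (M * T)).const_mul C)
  rw [mul_zero] at h0
  refine squeeze_zero (fun _ ↦ norm_nonneg _) (fun n ↦ ?_) h0
  have h := norm_sub_taylor_le hf hb n 0 T hT le_rfl
  rw [norm_sub_rev]
  simp only [zero_add] at h
  refine h.trans (le_of_eq ?_)
  rw [mul_pow]; ring

variable {n : ℕ}

/-- The symbol `|ξ|²` of `-Δ`, as an operator on Schwartz functions. -/
noncomputable def mulSymbol : 𝓢(E n, ℂ) →L[ℂ] 𝓢(E n, ℂ) :=
  SchwartzMap.smulLeftCLM ℂ (fun x : E n ↦ (((2 * Real.pi * ‖x‖) ^ 2 : ℝ) : ℂ))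

lemma hasTemperateGrowth_symbol :
    (fun x : E n ↦ (((2 * Real.pi * ‖x‖) ^ 2 : ℝ) : ℂ)).HasTemperateGrowth := by
  simp_rw [mul_pow]
  fun_prop

lemma mulSymbol_apply (ψ : 𝓢(E n, ℂ)) (x : E n) :
    mulSymbol ψ x = (((2 * Real.pi * ‖x‖) ^ 2 : ℝ) : ℂ) * ψ x := by
  rw [mulSymbol, SchwartzMap.smulLeftCLM_apply_apply hasTemperateGrowth_symbol, smul_eq_mul]

lemma fourier_laplacian_apply (T : 𝓢'(E n, ℂ)) (ψ : 𝓢(E n, ℂ)) :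
    𝓕 (Δ T) ψ = -𝓕 T (mulSymbol ψ) := by
  have h : mulSymbol ψ = ((2 * Real.pi) ^ 2 : ℝ) •
      SchwartzMap.smulLeftCLM ℂ (fun x : E n ↦ ((‖x‖ ^ 2 : ℝ) : ℂ)) ψ := by
    ext x
    rw [mulSymbol_apply, smul_apply,
      SchwartzMap.smulLeftCLM_apply_apply (by fun_prop)]
    simp [mul_pow]
    ring
  rw [TemperedDistribution.laplacian_eq_fourierMultiplierCLM,
    TemperedDistribution.fourierMultiplierCLM_apply, h, ← Complex.coe_smul,
    FourierTransform.fourier_smul, FourierTransform.fourier_fourierInv_eq, ← Complex.coe_smul,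
    map_smul]
  simp

lemma norm_toTemperedDistribution_apply_le (f : L2 n) (χ : 𝓢(E n, ℂ)) :
    ‖(f : 𝓢'(E n, ℂ)) χ‖ ≤ ‖χ.toLp 2 volume‖ * ‖f‖ := by
  have h : (f : 𝓢'(E n, ℂ)) χ = inner ℂ (star (χ.toLp 2 volume)) f := by
    rw [Lp.toTemperedDistribution_apply, L2.inner_def]
    refine integral_congr_ae ?_
    filter_upwards [Lp.coeFn_star (χ.toLp 2 volume), χ.coeFn_toLp 2 volume] with x h1 h2
    rw [h1, Pi.star_apply, h2, RCLike.inner_apply, smul_eq_mul, mul_comm]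
    simp
  rw [h]
  refine (norm_inner_le_norm _ _).trans ?_
  gcongr
  refine Lp.norm_le_norm_of_ae_le ?_
  filter_upwards [Lp.coeFn_star (χ.toLp 2 volume)] with x h1
  rw [h1, Pi.star_apply, norm_star]

/-- The constant serves every test function dominated pointwise by a multiple of `ψ`. This holds
because on the Fourier side the Bessel weight is a multiplication operator, so domination passes to
the weighted `L²` norms. It yields geometric bounds along the sequence of test functions in
`fourier_solution`. -/
lemma ContinuousInSobolev.exists_bound {s : ℝ} {w : ℝ → 𝓢'(E n, ℂ)} (h : ContinuousInSobolev s w)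
    (ψ : 𝓢(E n, ℂ)) (T : ℝ) : ∃ C : ℝ, 0 ≤ C ∧ ∀ t, 0 ≤ t → t ≤ T → ∀ (χ : 𝓢(E n, ℂ)) (m : ℝ),
      (∀ x, ‖χ x‖ ≤ m * ‖ψ x‖) → ‖𝓕 (w t) χ‖ ≤ C * m := by
  obtain ⟨W, hW, hw⟩ := h
  obtain ⟨C, hC⟩ := (isCompact_Icc (a := (0 : ℝ)) (b := T)).exists_bound_of_continuousOn
    (hW.mono Set.Icc_subset_Ici_self)
  set g : E n → ℂ := fun x ↦ (((1 + ‖x‖ ^ 2) ^ (-s / 2) : ℝ) : ℂ) with hg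
  have hgt : g.HasTemperateGrowth := by rw [hg]; fun_prop
  refine ⟨max C 0 * ‖(SchwartzMap.smulLeftCLM ℂ g ψ).toLp 2 volume‖, by positivity,
    fun t h0 hT χ m hm ↦ ?_⟩
  have hw' : w t = TemperedDistribution.besselPotential (E n) ℂ (-s) (W t : 𝓢'(E n, ℂ)) := by
    rw [← hw t h0]; simp
  have h1 : 𝓕 (w t) χ = ((𝓕 (W t) : L2 n) : 𝓢'(E n, ℂ)) (SchwartzMap.smulLeftCLM ℂ g χ) := by
    rw [hw', TemperedDistribution.fourier_besselPotential_eq_smulLeftCLM_fourier_apply,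
      ← Lp.fourier_toTemperedDistribution_eq]
    rfl
  have h2 : ‖(SchwartzMap.smulLeftCLM ℂ g χ).toLp 2 volume‖ ≤
      m * ‖(SchwartzMap.smulLeftCLM ℂ g ψ).toLp 2 volume‖ := by
    refine Lp.norm_le_mul_norm_of_ae_le_mul ?_
    filter_upwards [(SchwartzMap.smulLeftCLM ℂ g χ).coeFn_toLp 2 volume,
      (SchwartzMap.smulLeftCLM ℂ g ψ).coeFn_toLp 2 volume] with x h1 h2
    rw [h1, h2, SchwartzMap.smulLeftCLM_apply_apply hgt, SchwartzMap.smulLeftCLM_apply_apply hgt,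
      norm_smul, norm_smul]
    nlinarith [hm x, norm_nonneg (g x)]
  have h3 : ‖((𝓕 (W t) : L2 n) : 𝓢'(E n, ℂ)) (SchwartzMap.smulLeftCLM ℂ g χ)‖ ≤
      ‖(SchwartzMap.smulLeftCLM ℂ g χ).toLp 2 volume‖ * ‖(𝓕 (W t) : L2 n)‖ := norm_toTemperedDistribution_apply_le _ _
  rw [h1]
  refine h3.trans ?_
  rw [Lp.norm_fourier_eq]
  have h4 := (hC t ⟨h0, hT⟩).trans (le_max_left C 0)
  calc ‖(SchwartzMap.smulLeftCLM ℂ g χ).toLp 2 volume‖ * ‖W t‖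
      ≤ (m * ‖(SchwartzMap.smulLeftCLM ℂ g ψ).toLp 2 volume‖) * max C 0 := by
        gcongr
        exact (norm_nonneg _).trans h2
    _ = _ := by ring

lemma HasTimeDeriv.fourier {w z : ℝ → 𝓢'(E n, ℂ)} (h : HasTimeDeriv w z) (ψ : 𝓢(E n, ℂ)) {t : ℝ}
    (ht : 0 ≤ t) : HasDerivWithinAt (fun r ↦ 𝓕 (w r) ψ) (𝓕 (z t) ψ) (Set.Ici 0) t :=
  h (𝓕 ψ) t ht

/-- The action of the transposed generator on triples of test functions. -/
noncomputable def dualStep (σ : ℝ) (p : 𝓢(E n, ℂ) × 𝓢(E n, ℂ) × 𝓢(E n, ℂ)) :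
    𝓢(E n, ℂ) × 𝓢(E n, ℂ) × 𝓢(E n, ℂ) :=
  (-mulSymbol (mulSymbol p.2.1), p.1 - mulSymbol p.2.2,
    mulSymbol p.2.1 - mulSymbol p.2.2 - (σ : ℂ) • p.2.2)

lemma dualStep_iterate_apply (σ : ℝ) (ψ : 𝓢(E n, ℂ)) (k : ℕ) (x : E n) :
    ((dualStep σ)^[k] (ψ, 0, 0)).1 x = coeff σ ((2 * Real.pi * ‖x‖) ^ 2) k 0 * ψ x ∧
    ((dualStep σ)^[k] (ψ, 0, 0)).2.1 x = coeff σ ((2 * Real.pi * ‖x‖) ^ 2) k 1 * ψ x ∧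
    ((dualStep σ)^[k] (ψ, 0, 0)).2.2 x = coeff σ ((2 * Real.pi * ‖x‖) ^ 2) k 2 * ψ x := by
  induction k with
  | zero => simp [coeff_zero]
  | succ k ih =>
    obtain ⟨h0, h1, h2⟩ := ih
    obtain ⟨c0, c1, c2⟩ := coeff_succ σ ((2 * Real.pi * ‖x‖) ^ 2) k
    rw [Function.iterate_succ_apply']
    simp only [dualStep, sub_apply, neg_apply, smul_apply,
      mulSymbol_apply, h0, h1, h2, c0, c1, c2, smul_eq_mul]
    refine ⟨?_, ?_, ?_⟩ <;> (push_cast; ring)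

end ThermoPlate

namespace ThermoPlate

variable {n : ℕ}

open scoped Matrix.Norms.Operator

lemma continuous_symbol : Continuous fun x : E n ↦ (2 * Real.pi * ‖x‖) ^ 2 := by fun_prop

/-- The generator is bounded on the support of a compactly supported function. -/
lemma exists_genMatrix_bound (σ : ℝ) {ψ : E n → ℂ} (hψ : HasCompactSupport ψ) :
    ∃ M : ℝ, 0 ≤ M ∧ ∀ (k : ℕ) (i : Fin 3) (x : E n),
      ‖(coeff σ ((2 * Real.pi * ‖x‖) ^ 2) k i : ℂ) * ψ x‖ ≤ M ^ k * ‖ψ x‖ := by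
  obtain ⟨M, hM⟩ := hψ.isCompact.exists_bound_of_continuousOn
    (((continuous_genMatrix σ).comp continuous_symbol).continuousOn)
  refine ⟨max M 0, le_max_right _ _, fun k i x ↦ ?_⟩
  by_cases hx : x ∈ tsupport ψ
  · rw [norm_mul, Complex.norm_real]
    gcongr
    refine (abs_coeff_le _ _ _ _).trans ?_
    gcongr
    exact (hM x hx).trans (le_max_left _ _)
  · simp [image_eq_zero_of_notMem_tsupport hx]

/-- On the compact support of `ψ` the generator is bounded by some `M`, so the exponential series of
the kernel is dominated termwise by that of `exp(|t|M)`, and the sum passes through the integral. -/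
lemma hasSum_integral_kernel (σ t : ℝ) (i : Fin 3) {ψ : E n → ℂ} (hc : Continuous ψ)
    (hψ : HasCompactSupport ψ) (h : L2 n) :
    HasSum (fun k : ℕ ↦ ((t ^ k / (k.factorial : ℝ) : ℝ) : ℂ) *
        ∫ x, ((coeff σ ((2 * Real.pi * ‖x‖) ^ 2) k i : ℂ) * ψ x) * h x)
      (∫ x, ((kernel σ t ((2 * Real.pi * ‖x‖) ^ 2) i : ℂ) * ψ x) * h x) := by
  obtain ⟨M, hM0, hM⟩ := exists_genMatrix_bound σ hψ
  have hint : Integrable fun x ↦ ‖ψ x‖ * ‖h x‖ := by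
    have := ((hc.memLp_of_hasCompactSupport hψ (p := 2) (μ := volume)).integrable_mul
      (Lp.memLp h)).norm
    simpa using this
  simp_rw [← integral_const_mul]
  refine hasSum_integral_of_dominated_convergence
    (fun k x ↦ ((|t| * M) ^ k / (k.factorial : ℝ)) * (‖ψ x‖ * ‖h x‖)) (fun k ↦ ?_)
    (fun k ↦ ae_of_all _ fun x ↦ ?_) (ae_of_all _ fun x ↦ ?_) ?_ (ae_of_all _ fun x ↦ ?_)
  · have hk : Continuous fun x : E n ↦ (coeff σ ((2 * Real.pi * ‖x‖) ^ 2) k i : ℂ) :=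
      Complex.continuous_ofReal.comp ((continuous_coeff σ k i).comp continuous_symbol)
    exact (((hk.mul hc).aestronglyMeasurable).mul (Lp.aestronglyMeasurable h)).const_mul _
  · rw [norm_mul, norm_mul _ (h x), Complex.norm_real, Real.norm_eq_abs, abs_div, abs_pow,
      Nat.abs_cast]
    calc _ ≤ |t| ^ k / (k.factorial : ℝ) * ((M ^ k * ‖ψ x‖) * ‖h x‖) := by
          gcongr; exact hM k i x
      _ = _ := by rw [mul_pow]; ring
  · exact (Real.summable_pow_div_factorial _).mul_right _
  · simp_rw [tsum_mul_right]
    exact hint.const_mul _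
  · have := (hasSum_kernel σ t ((2 * Real.pi * ‖x‖) ^ 2) i)
    have h2 := ((Complex.hasSum_ofReal.2 this).mul_right (ψ x)).mul_right (h x)
    refine h2.congr_fun fun k ↦ ?_
    push_cast
    ring

/-- The solution formula in Fourier space. -/
theorem fourier_solution {σ : ℝ} {u₀ u₁ θ₀ : L2 n} {u : ℝ → L2 n} {θ : ℝ → 𝓢'(E n, ℂ)}
    (hsol : IsSolution σ u₀ u₁ θ₀ u θ) {t : ℝ} (ht : 0 ≤ t) :
    (𝓕 (u t) : L2 n) =ᵐ[volume] fun x ↦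
      (kernel σ t ((2 * Real.pi * ‖x‖) ^ 2) 0 : ℂ) * (𝓕 u₀ : L2 n) x
      + (kernel σ t ((2 * Real.pi * ‖x‖) ^ 2) 1 : ℂ) * (𝓕 u₁ : L2 n) x
      + (kernel σ t ((2 * Real.pi * ‖x‖) ^ 2) 2 : ℂ) * (𝓕 θ₀ : L2 n) x := by
  obtain ⟨hu, hθ, v, hv, hu', hv', hθ', hu0, hv0, hθ0⟩ := hsol
  have hus : ContinuousInSobolev 0 (fun t ↦ (u t : 𝓢'(E n, ℂ))) := ⟨u, hu, fun t _ ↦ by simp⟩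
  have hkc : ∀ i, Continuous fun x : E n ↦ (kernel σ t ((2 * Real.pi * ‖x‖) ^ 2) i : ℂ) := fun i ↦
    Complex.continuous_ofReal.comp ((continuous_kernel σ t i).comp continuous_symbol)
  have hloc : ∀ (i : Fin 3) (h : L2 n), LocallyIntegrable
      (fun x : E n ↦ (kernel σ t ((2 * Real.pi * ‖x‖) ^ 2) i : ℂ) * h x) := fun i h ↦ by
    rw [locallyIntegrable_iff]
    intro K hK
    exact (((Lp.memLp h).locallyIntegrable (by norm_num)).integrableOn_isCompact hK).continuousOn_mul
      (hkc i).continuousOn hK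
  refine ae_eq_of_integral_contDiff_smul_eq ((Lp.memLp _).locallyIntegrable (by norm_num))
    (((hloc 0 _).add (hloc 1 _)).add (hloc 2 _)) fun g hg hgs ↦ ?_
  have hg₁ : HasCompactSupport (Complex.ofRealCLM ∘ g) := hgs.comp_left rfl
  have hg₂ : ContDiff ℝ (⊤ : ℕ∞) (Complex.ofRealCLM ∘ g) := by fun_prop
  set ψ : 𝓢(E n, ℂ) := hg₁.toSchwartzMap hg₂ with hψ
  have hψa : ∀ x, ψ x = (g x : ℂ) := fun x ↦ by simp [hψ]
  have hψs : HasCompactSupport ψ := by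
    have : (ψ : E n → ℂ) = Complex.ofRealCLM ∘ g := by ext x; simp [hψ]
    rw [this]; exact hg₁
  -- Each time derivative is moved onto the test functions by the transposed generator, so the
  -- pairing is infinitely differentiable in time although the solution takes values in `H⁻²`.
  set p : ℕ → 𝓢(E n, ℂ) × 𝓢(E n, ℂ) × 𝓢(E n, ℂ) := fun k ↦ (dualStep σ)^[k] (ψ, 0, 0) with hp
  set f : ℕ → ℝ → ℂ := fun k s ↦ 𝓕 (u s : 𝓢'(E n, ℂ)) (p k).1 + 𝓕 (v s) (p k).2.1
    + 𝓕 (θ s) (p k).2.2 with hf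
  have hfd : ∀ k s, 0 ≤ s → HasDerivWithinAt (f k) (f (k + 1) s) (Set.Ici 0) s := fun k s hs ↦ by
    refine (((hu'.fourier (p k).1 hs).add (hv'.fourier (p k).2.1 hs)).add
      (hθ'.fourier (p k).2.2 hs)).congr_deriv ?_
    have hpk : p (k + 1) = dualStep σ (p k) := by simp only [hp, Function.iterate_succ_apply']
    simp only [hf, hpk, dualStep]
    simp only [FourierTransform.fourier_neg, FourierTransform.fourier_add,
      sub_eq_add_neg (Δ (θ s)), FourierTransform.fourier_smul, neg_apply, add_apply,
      smul_apply, fourier_laplacian_apply, map_sub, map_neg, map_smul, smul_eq_mul]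
    ring
  obtain ⟨M, hM0, hM⟩ := exists_genMatrix_bound σ hψs
  obtain ⟨C₁, hC₁, hb₁⟩ := hus.exists_bound ψ t
  obtain ⟨C₂, hC₂, hb₂⟩ := hv.exists_bound ψ t
  obtain ⟨C₃, hC₃, hb₃⟩ := hθ.exists_bound ψ t
  have hfb : ∀ k s, 0 ≤ s → s ≤ t → ‖f k s‖ ≤ (C₁ + C₂ + C₃) * M ^ k := fun k s hs hst ↦ by
    have e := fun x ↦ dualStep_iterate_apply σ ψ k x
    have h1 := hb₁ s hs hst (p k).1 (M ^ k) (fun x ↦ by rw [(e x).1]; exact hM k 0 x)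
    have h2 := hb₂ s hs hst (p k).2.1 (M ^ k) (fun x ↦ by rw [(e x).2.1]; exact hM k 1 x)
    have h3 := hb₃ s hs hst (p k).2.2 (M ^ k) (fun x ↦ by rw [(e x).2.2]; exact hM k 2 x)
    refine norm_add₃_le.trans ?_
    linarith
  have hT := tendsto_taylor hfd hfb ht
  have hS := ((hasSum_integral_kernel σ t 0 ψ.continuous hψs (𝓕 u₀ : L2 n)).add
    (hasSum_integral_kernel σ t 1 ψ.continuous hψs (𝓕 u₁ : L2 n))).add
    (hasSum_integral_kernel σ t 2 ψ.continuous hψs (𝓕 θ₀ : L2 n))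
  have hf0 : ∀ k, f k 0 =
      (∫ x, ((coeff σ ((2 * Real.pi * ‖x‖) ^ 2) k 0 : ℂ) * ψ x) * (𝓕 u₀ : L2 n) x)
      + (∫ x, ((coeff σ ((2 * Real.pi * ‖x‖) ^ 2) k 1 : ℂ) * ψ x) * (𝓕 u₁ : L2 n) x)
      + ∫ x, ((coeff σ ((2 * Real.pi * ‖x‖) ^ 2) k 2 : ℂ) * ψ x) * (𝓕 θ₀ : L2 n) x := fun k ↦ by
    have e := fun x ↦ dualStep_iterate_apply σ ψ k x
    simp only [hf, hu0, hv0, hθ0, Lp.fourier_toTemperedDistribution_eq,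
      Lp.toTemperedDistribution_apply, smul_eq_mul, hp, (e _).1, (e _).2.1, (e _).2.2]
  -- The partial sums of the Taylor series of the pairing and of the kernel series coincide term by
  -- term, so their limits agree; no separate uniqueness theorem is required.
  have hlim := tendsto_nhds_unique hT (by
    refine hS.tendsto_sum_nat.congr fun N ↦ Finset.sum_congr rfl fun k _ ↦ ?_
    rw [hf0]; ring)
  have hft : f 0 t = ∫ x, g x • (𝓕 (u t) : L2 n) x := by
    simp only [hf, hp, Function.iterate_zero, id, map_zero, add_zero,
      Lp.fourier_toTemperedDistribution_eq, Lp.toTemperedDistribution_apply, hψa]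
    rfl
  rw [← hft, hlim]
  have hint : ∀ (i : Fin 3) (h : L2 n), Integrable
      (fun x : E n ↦ ((kernel σ t ((2 * Real.pi * ‖x‖) ^ 2) i : ℂ) * ψ x) * h x) := fun i h ↦ by
    have := (hloc i h).integrable_smul_left_of_hasCompactSupport hg.continuous hgs
    refine this.congr (ae_of_all _ fun x ↦ ?_)
    simp only [hψa, Complex.real_smul]; ring
  have e₁ := integral_add (hint 0 (𝓕 u₀)) (hint 1 (𝓕 u₁))
  have e₂ := integral_add ((hint 0 (𝓕 u₀)).add (hint 1 (𝓕 u₁))) (hint 2 (𝓕 θ₀))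
  simp only [Pi.add_apply] at e₂
  rw [← e₁, ← e₂]
  refine integral_congr_ae (ae_of_all _ fun x ↦ ?_)
  simp only [hψa, Complex.real_smul]
  ring

end ThermoPlate

/-! ### Fourier transforms on `L¹ ∩ L²` and Plancherel. -/

namespace ThermoPlate

variable {n : ℕ}

/-- The Fourier transforms on `L¹` and on `L²` agree on `L¹ ∩ L²`. -/
lemma fourier_toLp_ae_eq {f : E n → ℂ} (h1 : Integrable f) (h2 : MemLp f 2) :
    (𝓕 (h2.toLp f) : L2 n) =ᵐ[volume] 𝓕 f := by
  have hcont : Continuous (𝓕 f) := VectorFourier.fourierIntegral_continuous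
    Real.continuous_fourierChar (by exact continuous_inner) h1
  refine ae_eq_of_integral_contDiff_smul_eq ((Lp.memLp _).locallyIntegrable (by norm_num))
    hcont.locallyIntegrable fun g hg hgs ↦ ?_
  have hg₁ : HasCompactSupport (Complex.ofRealCLM ∘ g) := hgs.comp_left rfl
  have hg₂ : ContDiff ℝ (⊤ : ℕ∞) (Complex.ofRealCLM ∘ g) := by fun_prop
  set ψ : 𝓢(E n, ℂ) := hg₁.toSchwartzMap hg₂ with hψ
  have hψa : ∀ x, ψ x = (g x : ℂ) := fun x ↦ by simp [hψ]
  calc ∫ x, g x • (𝓕 (h2.toLp f) : L2 n) x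
      = ((𝓕 (h2.toLp f) : L2 n) : 𝓢'(E n, ℂ)) ψ := by
        rw [Lp.toTemperedDistribution_apply]; simp only [hψa]; rfl
    _ = ∫ x, 𝓕 ψ x • (h2.toLp f) x := by
        rw [← Lp.fourier_toTemperedDistribution_eq, TemperedDistribution.fourier_apply,
          Lp.toTemperedDistribution_apply]
    _ = ∫ x, 𝓕 (ψ : E n → ℂ) x • f x := by
        refine integral_congr_ae ?_
        filter_upwards [h2.coeFn_toLp] with x hx
        rw [hx, SchwartzMap.fourier_coe]
    _ = ∫ x, ψ x • 𝓕 f x := by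
        simpa using! VectorFourier.integral_fourierIntegral_smul_eq_flip (L := innerₗ (E n))
          Real.continuous_fourierChar continuous_inner ψ.integrable h1
    _ = _ := by simp only [hψa]; rfl

lemma fourierInv_toLp_ae_eq {f : E n → ℂ} (h1 : Integrable f) (h2 : MemLp f 2) :
    (𝓕⁻ (h2.toLp f) : L2 n) =ᵐ[volume] 𝓕⁻ f := by
  have hcont : Continuous (𝓕⁻ f) := VectorFourier.fourierIntegral_continuous
    Real.continuous_fourierChar (by exact continuous_inner.neg) h1
  refine ae_eq_of_integral_contDiff_smul_eq ((Lp.memLp _).locallyIntegrable (by norm_num))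
    hcont.locallyIntegrable fun g hg hgs ↦ ?_
  have hg₁ : HasCompactSupport (Complex.ofRealCLM ∘ g) := hgs.comp_left rfl
  have hg₂ : ContDiff ℝ (⊤ : ℕ∞) (Complex.ofRealCLM ∘ g) := by fun_prop
  set ψ : 𝓢(E n, ℂ) := hg₁.toSchwartzMap hg₂ with hψ
  have hψa : ∀ x, ψ x = (g x : ℂ) := fun x ↦ by simp [hψ]
  calc ∫ x, g x • (𝓕⁻ (h2.toLp f) : L2 n) x
      = ((𝓕⁻ (h2.toLp f) : L2 n) : 𝓢'(E n, ℂ)) ψ := by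
        rw [Lp.toTemperedDistribution_apply]; simp only [hψa]; rfl
    _ = ∫ x, 𝓕⁻ ψ x • (h2.toLp f) x := by
        rw [← Lp.fourierInv_toTemperedDistribution_eq, TemperedDistribution.fourierInv_apply,
          Lp.toTemperedDistribution_apply]
    _ = ∫ x, 𝓕⁻ (ψ : E n → ℂ) x • f x := by
        refine integral_congr_ae ?_
        filter_upwards [h2.coeFn_toLp] with x hx
        rw [hx, SchwartzMap.fourierInv_coe]
    _ = ∫ x, ψ x • 𝓕⁻ f x := by
        have h := VectorFourier.integral_fourierIntegral_smul_eq_flip (L := -innerₗ (E n))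
          Real.continuous_fourierChar
          (by exact continuous_inner.neg) (ψ.integrable (μ := volume)) h1
        have hflip : (-innerₗ (E n)).flip = -innerₗ (E n) := by
          ext x y; simp [real_inner_comm]
        rw [hflip] at h
        exact h
    _ = _ := by simp only [hψa]; rfl

/-- Plancherel for the difference of an `L²` function and an inverse Fourier integral. -/
lemma eLpNorm_sub_fourierInv (w : L2 n) {f : E n → ℂ} (h1 : Integrable f) (h2 : MemLp f 2) :
    eLpNorm (fun x ↦ w x - 𝓕⁻ f x) 2 = eLpNorm (fun x ↦ (𝓕 w : L2 n) x - f x) 2 := by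
  have e1 : eLpNorm (fun x ↦ w x - 𝓕⁻ f x) 2 = ‖w - 𝓕⁻ (h2.toLp f)‖ₑ := by
    rw [Lp.enorm_def]
    refine eLpNorm_congr_ae ?_
    filter_upwards [Lp.coeFn_sub w (𝓕⁻ (h2.toLp f)), fourierInv_toLp_ae_eq h1 h2] with x h3 h4
    rw [h3, Pi.sub_apply, h4]
  have e2 : eLpNorm (fun x ↦ (𝓕 w : L2 n) x - f x) 2 = ‖𝓕 w - h2.toLp f‖ₑ := by
    rw [Lp.enorm_def]
    refine eLpNorm_congr_ae ?_
    filter_upwards [Lp.coeFn_sub (𝓕 w) (h2.toLp f), h2.coeFn_toLp] with x h3 h4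
    rw [h3, Pi.sub_apply, h4]
  have e3 : (𝓕 w - h2.toLp f : L2 n) = 𝓕 (w - 𝓕⁻ (h2.toLp f)) := by
    rw [sub_eq_add_neg w, FourierTransform.fourier_add, FourierTransform.fourier_neg,
      FourierTransform.fourier_fourierInv_eq, sub_eq_add_neg]
  rw [e1, e2, e3, ← ofReal_norm, ← ofReal_norm, Lp.norm_fourier_eq]

lemma memLp_fourierInv {f : E n → ℂ} (h1 : Integrable f) (h2 : MemLp f 2) : MemLp (𝓕⁻ f) 2 :=
  (memLp_congr_ae (fourierInv_toLp_ae_eq h1 h2)).1 (Lp.memLp _)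

lemma fourierInv_add {f g : E n → ℂ} (hf : Integrable f) (hg : Integrable g) (x : E n) :
    𝓕⁻ (fun y ↦ f y + g y) x = 𝓕⁻ f x + 𝓕⁻ g x :=
  congrFun (VectorFourier.fourierIntegral_add (L := -innerₗ (E n)) Real.continuous_fourierChar
    (by exact continuous_inner.neg) hf hg) x

lemma fourierInv_const_mul (c : ℂ) (f : E n → ℂ) (x : E n) :
    𝓕⁻ (fun y ↦ c * f y) x = c * 𝓕⁻ f x :=
  congrFun (VectorFourier.fourierIntegral_const_smul Real.fourierChar volume (-innerₗ (E n)) f c) x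

lemma fourierInv_sum {ι : Type*} (s : Finset ι) {f : ι → E n → ℂ} (hf : ∀ i, Integrable (f i))
    (x : E n) : 𝓕⁻ (fun y ↦ ∑ i ∈ s, f i y) x = ∑ i ∈ s, 𝓕⁻ (f i) x := by
  classical
  induction s using Finset.induction_on with
  | empty => simp [Real.fourierInv_eq]
  | insert a s ha ih =>
    simp_rw [Finset.sum_insert ha]
    rw [fourierInv_add (hf a) (integrable_finsetSum _ fun i _ ↦ hf i), ih]

/-! ### Radial integrals -/

/-- The area of the unit sphere of `ℝⁿ`. -/
noncomputable def sphereArea (n : ℕ) : ℝ := n * volume.real (Metric.ball (0 : E n) 1)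

lemma sphereArea_nonneg (n : ℕ) : 0 ≤ sphereArea n := by unfold sphereArea; positivity

lemma eLpNorm_radial_le (hn : 1 ≤ n) {f : ℝ → ℝ} (hf : Measurable f) {K : ℝ}
    (hint : IntegrableOn (fun r ↦ r ^ (n - 1) * f r ^ 2) (Set.Ioi 0))
    (hK : ∫ r in Set.Ioi (0 : ℝ), r ^ (n - 1) * f r ^ 2 ≤ K) :
    MemLp (fun x : E n ↦ f ‖x‖) 2 ∧
    eLpNorm (fun x : E n ↦ f ‖x‖) 2 ≤ ENNReal.ofReal (Real.sqrt (sphereArea n * K)) := by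
  have : NeZero n := ⟨by omega⟩
  have hdim : Module.finrank ℝ (E n) = n := by simp
  have hi : Integrable fun x : E n ↦ f ‖x‖ ^ 2 := by
    rw [integrable_fun_norm_addHaar volume (f := fun r ↦ f r ^ 2), hdim]
    simpa using hint
  have hm : MemLp (fun x : E n ↦ f ‖x‖) 2 :=
    (memLp_two_iff_integrable_sq (hf.comp measurable_norm).aestronglyMeasurable).2 hi
  refine ⟨hm, ?_⟩
  rw [hm.eLpNorm_eq_integral_rpow_norm (by norm_num) (by norm_num)]
  refine ENNReal.ofReal_le_ofReal ?_
  rw [Real.sqrt_eq_rpow]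
  have h2 : ∫ x : E n, ‖f ‖x‖‖ ^ (2 : ℝ≥0∞).toReal
      = sphereArea n * ∫ r in Set.Ioi (0 : ℝ), r ^ (n - 1) * f r ^ 2 := by
    have := integral_fun_norm_addHaar (volume : Measure (E n)) (fun r ↦ f r ^ 2)
    rw [hdim] at this
    simp only [smul_eq_mul, nsmul_eq_mul] at this
    simp only [ENNReal.toReal_ofNat, Real.rpow_ofNat, Real.norm_eq_abs, sq_abs]
    rw [this, sphereArea, mul_assoc]
  rw [h2]
  norm_num
  refine Real.rpow_le_rpow ?_ ?_ (by norm_num)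
  · refine mul_nonneg (sphereArea_nonneg n) (setIntegral_nonneg measurableSet_Ioi fun r hr ↦ ?_)
    have : (0 : ℝ) < r := hr
    positivity
  · exact mul_le_mul_of_nonneg_left hK (sphereArea_nonneg n)

lemma integrableOn_pow_mul_exp_quartic {q b : ℝ} (hq : -1 < q) (hb : 0 < b) :
    IntegrableOn (fun r : ℝ ↦ r ^ q * Real.exp (-b * r ^ 4)) (Set.Ioi 0) := by
  have := integrableOn_rpow_mul_exp_neg_mul_rpow hq (p := 4) (by norm_num) hb
  simpa using! this

lemma integral_pow_mul_exp_quartic {q b : ℝ} (hq : -1 < q) (hb : 0 < b) :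
    ∫ r in Set.Ioi (0 : ℝ), r ^ q * Real.exp (-b * r ^ 4)
      = b ^ (-(q + 1) / 4) * (1 / 4) * Real.Gamma ((q + 1) / 4) := by
  have := integral_rpow_mul_exp_neg_mul_rpow (p := 4) (by norm_num) hq hb
  simpa using! this

/-- The `L²` norm of `r^q exp(-c t r⁴)` on `ℝⁿ`, by scaling. -/
lemma exists_eLpNorm_quartic_le (hn : 1 ≤ n) {q c : ℝ} (hq : 0 < n + 2 * q) (hc : 0 < c) :
    ∃ K : ℝ, 0 ≤ K ∧ ∀ t : ℝ, 0 < t →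
      MemLp (fun x : E n ↦ ‖x‖ ^ q * Real.exp (-(c * t * ‖x‖ ^ 4))) 2 ∧
      eLpNorm (fun x : E n ↦ ‖x‖ ^ q * Real.exp (-(c * t * ‖x‖ ^ 4))) 2 ≤
        ENNReal.ofReal (K * t ^ (-(n + 2 * q) / 8)) := by
  set A : ℝ := sphereArea n * ((2 * c) ^ (-(n + 2 * q) / 4) * (1 / 4) * Real.Gamma ((n + 2 * q) / 4))
    with hA
  have hA0 : 0 ≤ A := by
    have := sphereArea_nonneg n
    have := Real.Gamma_pos_of_pos (show 0 < (n + 2 * q) / 4 by positivity)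
    positivity
  refine ⟨Real.sqrt A, Real.sqrt_nonneg _, fun t ht ↦ ?_⟩
  have hq' : -1 < (n : ℝ) - 1 + 2 * q := by linarith
  have hb : 0 < 2 * c * t := by positivity
  -- The exponent `n - 1` is the polar Jacobian, and `2q` and `2c` come from squaring.
  have heq : ∀ r ∈ Set.Ioi (0 : ℝ), r ^ ((n : ℝ) - 1 + 2 * q) * Real.exp (-(2 * c * t) * r ^ 4)
      = r ^ (n - 1) * (r ^ q * Real.exp (-(c * t * r ^ 4))) ^ 2 := fun r hr ↦ by
    have hr0 : (0 : ℝ) < r := hr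
    rw [mul_pow, ← Real.exp_nat_mul, ← Real.rpow_natCast (r ^ q) 2, ← Real.rpow_mul hr0.le,
      ← Real.rpow_natCast r (n - 1), ← mul_assoc, ← Real.rpow_add hr0, Nat.cast_sub hn]
    congr 2 <;> (push_cast; ring)
  have hint := (integrableOn_pow_mul_exp_quartic hq' hb).congr_fun heq measurableSet_Ioi
  have hval : ∫ r in Set.Ioi (0 : ℝ), r ^ (n - 1) * (r ^ q * Real.exp (-(c * t * r ^ 4))) ^ 2
      = (2 * c * t) ^ (-(n + 2 * q) / 4) * (1 / 4) * Real.Gamma ((n + 2 * q) / 4) := by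
    rw [← setIntegral_congr_fun measurableSet_Ioi heq, integral_pow_mul_exp_quartic hq' hb]
    congr 3 <;> ring
  obtain ⟨h1, h2⟩ := eLpNorm_radial_le hn
    (f := fun r ↦ r ^ q * Real.exp (-(c * t * r ^ 4))) (by fun_prop) hint hval.le
  refine ⟨h1, h2.trans (le_of_eq ?_)⟩
  congr 1
  rw [show sphereArea n * ((2 * c * t) ^ (-(n + 2 * q) / 4) * (1 / 4) * Real.Gamma ((n + 2 * q) / 4))
    = A * (t ^ (-(n + 2 * q) / 8)) ^ 2 by
      rw [hA, Real.mul_rpow (by positivity) ht.le, ← Real.rpow_natCast, ← Real.rpow_mul ht.le]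
      rw [show -(n + 2 * q) / 8 * ((2 : ℕ) : ℝ) = -(n + 2 * q) / 4 by push_cast; ring]
      ring]
  rw [Real.sqrt_mul hA0, Real.sqrt_sq (by positivity)]

end ThermoPlate

/-! ### Differentiating inverse Fourier integrals of rapidly decaying symbols. -/

namespace ThermoPlate

variable {n : ℕ}

/-- Functions dominated by `C exp(-b |η|⁴)`. -/
def QuarticDecay (f : E n → ℂ) : Prop :=
  AEStronglyMeasurable f volume ∧
    ∃ C b : ℝ, 0 < b ∧ ∀ x, ‖f x‖ ≤ C * Real.exp (-(b * ‖x‖ ^ 4))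

lemma fourierSMulRight_single (f : E n → ℂ) (y : E n) (i : Fin n) :
    VectorFourier.fourierSMulRight (innerSL ℝ) f y (EuclideanSpace.single i 1)
      = -(2 * Real.pi * Complex.I) * ((y i : ℂ) * f y) := by
  have h : inner ℝ y (EuclideanSpace.single i (1 : ℝ)) = y i := by
    simp [EuclideanSpace.inner_single_right]
  calc _ = -(2 * Real.pi * Complex.I) • (inner ℝ y (EuclideanSpace.single i (1 : ℝ)) • f y) := rfl
    _ = _ := by rw [h, smul_eq_mul, Complex.real_smul]

lemma fourierPowSMulRight_single (f : E n → ℂ) (y : E n) (i : Fin n) :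
    VectorFourier.fourierPowSMulRight (innerSL ℝ) f y 2
        ![EuclideanSpace.single i 1, EuclideanSpace.single i 1]
      = (-(2 * Real.pi * Complex.I)) ^ 2 * ((y i : ℂ) ^ 2 * f y) := by
  have h : inner ℝ y (EuclideanSpace.single i (1 : ℝ)) = y i := by
    simp [EuclideanSpace.inner_single_right]
  rw [VectorFourier.fourierPowSMulRight_apply, Fin.prod_univ_two]
  calc _ = (-(2 * Real.pi * Complex.I)) ^ 2 • ((inner ℝ y (EuclideanSpace.single i (1 : ℝ)) *
        inner ℝ y (EuclideanSpace.single i (1 : ℝ))) • f y) := rfl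
    _ = _ := by rw [h, smul_eq_mul, Complex.real_smul]; push_cast; ring

namespace QuarticDecay

variable {f g : E n → ℂ}

lemma memLp_two (hf : QuarticDecay f) (hn : 1 ≤ n) : MemLp f 2 := by
  obtain ⟨hm, C, b, hb, hC⟩ := hf
  obtain ⟨K, -, hK⟩ := exists_eLpNorm_quartic_le hn (q := 0)
    (by have : (1 : ℝ) ≤ n := by exact_mod_cast hn
        linarith) hb
  refine ((hK 1 one_pos).1.const_mul C).mono hm (ae_of_all _ fun x ↦ ?_)
  refine (hC x).trans ((le_abs_self _).trans (le_of_eq ?_))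
  simp

lemma integrable (hf : QuarticDecay f) (hn : 1 ≤ n) : Integrable f := by
  obtain ⟨hm, C, b, hb, hC⟩ := hf
  -- At half the rate, the square of the `L²` majorant is the required `L¹` majorant.
  obtain ⟨K, -, hK⟩ := exists_eLpNorm_quartic_le hn (q := 0)
    (by have : (1 : ℝ) ≤ n := by exact_mod_cast hn
        linarith) (half_pos hb)
  refine ((hK 1 one_pos).1.integrable_sq.const_mul C).mono' hm (ae_of_all _ fun x ↦ ?_)
  refine (hC x).trans (le_of_eq ?_)
  rw [Real.rpow_zero, one_mul, ← Real.exp_nat_mul]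
  congr 2
  push_cast
  ring

lemma add (hf : QuarticDecay f) (hg : QuarticDecay g) : QuarticDecay fun x ↦ f x + g x := by
  obtain ⟨hm, C, b, hb, hC⟩ := hf
  obtain ⟨hm', C', b', hb', hC'⟩ := hg
  refine ⟨hm.add hm', max C 0 + max C' 0, min b b', lt_min hb hb', fun x ↦ ?_⟩
  rw [add_mul]
  refine (norm_add_le _ _).trans (add_le_add ((hC x).trans ?_) ((hC' x).trans ?_))
  · gcongr
    · exact le_max_left _ _
    · exact min_le_left _ _
  · gcongr
    · exact le_max_left _ _
    · exact min_le_right _ _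

lemma const_mul (hf : QuarticDecay f) (c : ℂ) : QuarticDecay fun x ↦ c * f x := by
  obtain ⟨hm, C, b, hb, hC⟩ := hf
  refine ⟨hm.const_mul c, ‖c‖ * C, b, hb, fun x ↦ ?_⟩
  rw [norm_mul, mul_assoc]
  gcongr
  exact hC x

lemma sum {ι : Type*} (s : Finset ι) {f : ι → E n → ℂ} (hf : ∀ i, QuarticDecay (f i)) :
    QuarticDecay fun x ↦ ∑ i ∈ s, f i x := by
  classical
  induction s using Finset.induction_on with
  | empty => exact ⟨by simpa using aestronglyMeasurable_const, 0, 1, one_pos, by simp⟩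
  | insert a s ha ih => simp_rw [Finset.sum_insert ha]; exact (hf a).add ih

/-- Half of the exponential absorbs quartic growth. This covers the factors `ξᵢ` and `|ξ|²` produced
by the gradient and the Laplacian. -/
lemma mul_growth (hf : QuarticDecay f) (hg : AEStronglyMeasurable g volume) {A : ℝ}
    (hA : ∀ x, ‖g x‖ ≤ A * (1 + ‖x‖ ^ 4)) : QuarticDecay fun x ↦ g x * f x := by
  obtain ⟨hm, C, b, hb, hC⟩ := hf
  have hA0 : 0 ≤ A := by
    have := (norm_nonneg _).trans (hA 0)
    simpa using this
  refine ⟨hg.mul hm, A * (1 + 2 / b) * max C 0, b / 2, half_pos hb, fun x ↦ ?_⟩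
  have h1 : 1 + ‖x‖ ^ 4 ≤ (1 + 2 / b) * Real.exp (b / 2 * ‖x‖ ^ 4) := by
    have h2 := Real.add_one_le_exp (b / 2 * ‖x‖ ^ 4)
    have h3 : 0 ≤ b / 2 * ‖x‖ ^ 4 := by positivity
    have h4 : ‖x‖ ^ 4 = 2 / b * (b / 2 * ‖x‖ ^ 4) := by field_simp
    have h5 : 0 < 2 / b := by positivity
    nlinarith
  have h6 := (hC x).trans (mul_le_mul_of_nonneg_right (le_max_left C 0) (Real.exp_pos _).le)
  calc ‖g x * f x‖ = ‖g x‖ * ‖f x‖ := norm_mul _ _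
    _ ≤ (A * ((1 + 2 / b) * Real.exp (b / 2 * ‖x‖ ^ 4)))
        * (max C 0 * Real.exp (-(b * ‖x‖ ^ 4))) := by
      gcongr
      exact (hA x).trans (by gcongr)
    _ = A * (1 + 2 / b) * max C 0 * Real.exp (-(b / 2 * ‖x‖ ^ 4)) := by
      rw [show -(b / 2 * ‖x‖ ^ 4) = b / 2 * ‖x‖ ^ 4 + -(b * ‖x‖ ^ 4) by ring, Real.exp_add]
      ring

lemma coord_mul (hf : QuarticDecay f) (i : Fin n) :
    QuarticDecay fun x ↦ (2 * Real.pi * Complex.I * (x i : ℂ)) * f x := by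
  refine hf.mul_growth (A := 2 * Real.pi) (by fun_prop) fun x ↦ ?_
  have h1 : |x i| ≤ ‖x‖ := PiLp.norm_apply_le x i
  have h2 : ‖x‖ ≤ 1 + ‖x‖ ^ 4 := by nlinarith [sq_nonneg (‖x‖ - 1), sq_nonneg (‖x‖ ^ 2 - 1)]
  simp only [norm_mul, Complex.norm_I, Complex.norm_real, Real.norm_eq_abs, Complex.norm_ofNat,
    mul_one, abs_of_pos Real.pi_pos]
  gcongr
  exact h1.trans h2

lemma sq_mul (hf : QuarticDecay f) :
    QuarticDecay fun x ↦ (((2 * Real.pi * ‖x‖) ^ 2 : ℝ) : ℂ) * f x := by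
  refine hf.mul_growth (A := (2 * Real.pi) ^ 2) (by fun_prop) fun x ↦ ?_
  rw [Complex.norm_real, Real.norm_eq_abs, abs_of_nonneg (by positivity), mul_pow]
  gcongr
  nlinarith [sq_nonneg (‖x‖ ^ 2 - 1)]

lemma integrable_pow_mul (hf : QuarticDecay f) (hn : 1 ≤ n) {k : ℕ} (hk : k ≤ 2) :
    Integrable fun x ↦ ‖x‖ ^ k * ‖f x‖ := by
  have h : QuarticDecay fun x ↦ ((‖x‖ ^ k : ℝ) : ℂ) * f x := by
    refine hf.mul_growth (A := 1) (by fun_prop) fun x ↦ ?_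
    rw [Complex.norm_real, Real.norm_eq_abs, abs_of_nonneg (by positivity), one_mul]
    interval_cases k <;> nlinarith [sq_nonneg (‖x‖ - 1), sq_nonneg (‖x‖ ^ 2 - 1)]
  refine (h.integrable hn).norm.congr (ae_of_all _ fun x ↦ ?_)
  simp

/-- Radial symbols are even, so the derivative formulas for `𝓕` apply to `𝓕⁻`. -/
lemma fourierInv_eq_fourier_of_even (he : ∀ x, f (-x) = f x) : 𝓕⁻ f = 𝓕 f := by
  rw [Real.fourierInv_eq_fourier_comp_neg]; simp only [he]

lemma fderiv_fourierInv (hf : QuarticDecay f) (hn : 1 ≤ n) (he : ∀ x, f (-x) = f x) (x : E n)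
    (i : Fin n) : fderiv ℝ (𝓕⁻ f) x (EuclideanSpace.single i 1)
      = 𝓕⁻ (fun y ↦ (2 * Real.pi * Complex.I * (y i : ℂ)) * f y) x := by
  have h1 : Integrable fun v ↦ ‖v‖ * ‖f v‖ := by
    simpa using hf.integrable_pow_mul hn (k := 1) (by norm_num)
  have h2 : Integrable (VectorFourier.fourierSMulRight (innerSL ℝ) f) := by
    have hm := hf.1.fourierSMulRight (L := innerSL ℝ)
    refine (h1.const_mul (2 * Real.pi)).mono' hm (ae_of_all _ fun v ↦ ?_)
    rw [VectorFourier.norm_fourierSMulRight, innerSL_apply_norm]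
    exact (mul_assoc _ _ _).le
  rw [fourierInv_eq_fourier_of_even he, Real.fderiv_fourier (hf.integrable hn) h1,
    Real.fourier_continuousLinearMap_apply h2, Real.fourierInv_eq_fourier_comp_neg]
  refine congrArg (fun g : E n → ℂ ↦ 𝓕 g x) (funext fun y ↦ ?_)
  rw [fourierSMulRight_single]
  simp [he]
  ring

lemma laplacian_fourierInv (hf : QuarticDecay f) (hn : 1 ≤ n) (he : ∀ x, f (-x) = f x) (x : E n) :
    Δ (𝓕⁻ f) x = 𝓕⁻ (fun y ↦ (-1 : ℂ) * ((((2 * Real.pi * ‖y‖) ^ 2 : ℝ) : ℂ) * f y)) x := by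
  have hk : ∀ k : ℕ, (k : ℕ∞) ≤ (2 : ℕ) → Integrable fun v ↦ ‖v‖ ^ k * ‖f v‖ := fun k hk ↦
    hf.integrable_pow_mul hn (by exact_mod_cast hk)
  have hi := VectorFourier.integrable_fourierPowSMulRight (innerSL ℝ)
    (hf.integrable_pow_mul hn (le_refl 2)) hf.1
  rw [fourierInv_eq_fourier_of_even he,
    InnerProductSpace.laplacian_eq_iteratedFDeriv_orthonormalBasis (𝓕 f)
      (EuclideanSpace.basisFun (Fin n) ℝ),
    Real.iteratedFDeriv_fourier (N := (2 : ℕ)) hk hf.1 (n := 2) (by norm_num)]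
  simp_rw [Real.fourier_continuousMultilinearMap_apply hi]
  have key : ∀ i, 𝓕 (fun v ↦ VectorFourier.fourierPowSMulRight (innerSL ℝ) f v 2
      ![EuclideanSpace.basisFun (Fin n) ℝ i, EuclideanSpace.basisFun (Fin n) ℝ i]) x
      = 𝓕⁻ (fun y ↦ (2 * Real.pi * Complex.I * (y i : ℂ))
        * ((2 * Real.pi * Complex.I * (y i : ℂ)) * f y)) x := fun i ↦ by
    rw [fourierInv_eq_fourier_of_even (fun y ↦ by simp [he])]
    refine congrArg (fun g : E n → ℂ ↦ 𝓕 g x) (funext fun y ↦ ?_)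
    rw [EuclideanSpace.basisFun_apply, fourierPowSMulRight_single]
    ring
  simp_rw [key]
  rw [← fourierInv_sum _ (fun i ↦ ((hf.coord_mul i).coord_mul i).integrable hn)]
  refine congrArg (fun g : E n → ℂ ↦ 𝓕⁻ g x) (funext fun y ↦ ?_)
  rw [mul_pow, EuclideanSpace.real_norm_sq_eq]
  push_cast
  rw [← mul_assoc, Finset.mul_sum, Finset.mul_sum, Finset.sum_mul]
  refine Finset.sum_congr rfl fun i _ ↦ ?_
  linear_combination (4 * (Real.pi : ℂ) ^ 2 * (y i : ℂ) ^ 2 * f y) * Complex.I_sq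

end QuarticDecay

end ThermoPlate

/-! ### Symbols of the profile. -/

namespace ThermoPlate

variable {n : ℕ}

/-- A radial symbol `m(|ξ|)`, as a function of `η = ξ / 2π`. -/
noncomputable def radialSymbol (n : ℕ) (m : ℝ → ℝ) (x : E n) : ℂ :=
  ((m (2 * Real.pi * ‖x‖) : ℝ) : ℂ)

lemma radialSymbol_even (m : ℝ → ℝ) (x : E n) : radialSymbol n m (-x) = radialSymbol n m x := by
  simp [radialSymbol]

lemma quarticDecay_radialSymbol {m : ℝ → ℝ} (hm : Measurable m) {C b : ℝ} (hb : 0 < b)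
    (h : ∀ r, 0 ≤ r → |m r| ≤ C * Real.exp (-(r ^ 4 * b))) : QuarticDecay (radialSymbol n m) := by
  refine ⟨(Complex.measurable_ofReal.comp (hm.comp (by fun_prop))).aestronglyMeasurable, C,
    (2 * Real.pi) ^ 4 * b, by positivity, fun x ↦ ?_⟩
  rw [radialSymbol, Complex.norm_real]
  refine (h _ (by positivity)).trans (le_of_eq ?_)
  congr 2
  ring

/-- The radial Fourier multiplier of `J₀`. -/
noncomputable def symbolJ0 (σ t r : ℝ) : ℝ :=
  Real.sin (r ^ 2 * t) / r ^ 2 * Real.exp (-(r ^ 4 * t / (2 * σ)))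

/-- The radial Fourier multiplier of `J₁`. -/
noncomputable def symbolJ1 (σ t r : ℝ) : ℝ :=
  Real.cos (r ^ 2 * t) * Real.exp (-(r ^ 4 * t / (2 * σ)))

/-- The radial Fourier multiplier of `H`, without the factor `t / (8 σ²)`. -/
noncomputable def symbolH (σ t r : ℝ) : ℝ :=
  ((2 * σ + 1) * Real.cos (r ^ 2 * t) + 4 * Real.sin (r ^ 2 * t)) * r ^ 4 *
    Real.exp (-(r ^ 4 * t / (2 * σ)))

lemma abs_symbolJ0_le {t : ℝ} (σ r : ℝ) (ht : 0 < t) :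
    |symbolJ0 σ t r| ≤ t * Real.exp (-(r ^ 4 * t / (2 * σ))) := by
  rw [symbolJ0, abs_mul, Real.abs_exp]
  gcongr
  rcases eq_or_ne r 0 with rfl | hr
  · simpa using ht.le
  · have hr2 : 0 < r ^ 2 := by positivity
    rw [abs_div, abs_of_pos hr2, div_le_iff₀ hr2]
    refine (Real.abs_sin_le_abs).trans (le_of_eq ?_)
    rw [abs_of_pos (by positivity)]; ring

lemma abs_symbolJ1_le (σ t r : ℝ) :
    |symbolJ1 σ t r| ≤ Real.exp (-(r ^ 4 * t / (2 * σ))) := by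
  rw [symbolJ1, abs_mul, Real.abs_exp]
  exact mul_le_of_le_one_left (Real.exp_pos _).le (Real.abs_cos_le_one _)

/-- The growth `t r⁴` is absorbed by half of the exponential, hence `4σ` in place of `2σ`. The
correction `H` thus has a bounded symbol with quartic decay and is only an error term. -/
lemma abs_symbolH_le {σ t : ℝ} (hσ : 0 < σ) (ht : 0 < t) (r : ℝ) :
    t / (8 * σ ^ 2) * |symbolH σ t r| ≤ (2 * σ + 5) / (2 * σ) *
      Real.exp (-(r ^ 4 * t / (4 * σ))) := by
  have h1 : |(2 * σ + 1) * Real.cos (r ^ 2 * t) + 4 * Real.sin (r ^ 2 * t)| ≤ 2 * σ + 5 := by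
    have hc := abs_le.1 (Real.abs_cos_le_one (r ^ 2 * t))
    have hs := abs_le.1 (Real.abs_sin_le_one (r ^ 2 * t))
    rw [abs_le]
    constructor <;> nlinarith
  have h2 : r ^ 4 * t / (4 * σ) ≤ Real.exp (r ^ 4 * t / (4 * σ)) := by
    have := Real.add_one_le_exp (r ^ 4 * t / (4 * σ)); linarith
  have hr : 0 ≤ r ^ 4 := by positivity
  rw [symbolH, abs_mul, abs_mul, Real.abs_exp, abs_of_nonneg hr]
  calc _ ≤ t / (8 * σ ^ 2) * ((2 * σ + 5) * r ^ 4 * Real.exp (-(r ^ 4 * t / (2 * σ)))) := by gcongr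
    _ = (2 * σ + 5) / (2 * σ) * ((r ^ 4 * t / (4 * σ)) * Real.exp (-(r ^ 4 * t / (2 * σ)))) := by
      field_simp; ring
    _ ≤ (2 * σ + 5) / (2 * σ) *
        (Real.exp (r ^ 4 * t / (4 * σ)) * Real.exp (-(r ^ 4 * t / (2 * σ)))) := by gcongr
    _ = _ := by
      rw [← Real.exp_add]; congr 2; field_simp; ring

lemma quarticDecay_symbols {σ t : ℝ} (hσ : 0 < σ) (ht : 0 < t) :
    QuarticDecay (radialSymbol n (symbolJ0 σ t)) ∧ QuarticDecay (radialSymbol n (symbolJ1 σ t)) ∧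
    QuarticDecay (radialSymbol n (symbolH σ t)) := by
  have hb : 0 < t / (2 * σ) := by positivity
  have hb' : 0 < t / (4 * σ) := by positivity
  refine ⟨quarticDecay_radialSymbol (C := t) (by unfold symbolJ0; fun_prop) hb fun r _ ↦ ?_,
    quarticDecay_radialSymbol (C := 1) (by unfold symbolJ1; fun_prop) hb fun r _ ↦ ?_,
    quarticDecay_radialSymbol (C := (8 * σ ^ 2 / t) * ((2 * σ + 5) / (2 * σ)))
      (by unfold symbolH; fun_prop) hb' fun r _ ↦ ?_⟩
  · rw [← mul_div_assoc]; exact abs_symbolJ0_le σ r ht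
  · rw [← mul_div_assoc, one_mul]; exact abs_symbolJ1_le σ t r
  · have h := abs_symbolH_le hσ ht r
    rw [← mul_div_assoc (r ^ 4), mul_assoc]
    calc |symbolH σ t r| = 8 * σ ^ 2 / t * (t / (8 * σ ^ 2) * |symbolH σ t r|) := by field_simp
      _ ≤ _ := by gcongr

/-- The symbol of the profile. -/
noncomputable def profileSymbol (σ : ℝ) (u₀ u₁ θ₀ : E n → ℂ) (t : ℝ) (x : E n) : ℂ :=
  (meanP u₁ * radialSymbol n (symbolJ0 σ t) x
    + (-1 : ℂ) * ∑ i, momentM u₁ i *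
        ((2 * Real.pi * Complex.I * (x i : ℂ)) * radialSymbol n (symbolJ0 σ t) x))
    + (meanP u₁ * ((t / (8 * σ ^ 2) : ℝ) : ℂ)) * radialSymbol n (symbolH σ t) x
    + meanP u₀ * radialSymbol n (symbolJ1 σ t) x
    + ((σ : ℂ)⁻¹ * meanP θ₀) * ((((2 * Real.pi * ‖x‖) ^ 2 : ℝ) : ℂ) *
        radialSymbol n (symbolJ0 σ t) x)

lemma profileSymbol_spec {σ t : ℝ} (hσ : 0 < σ) (ht : 0 < t) (hn : 1 ≤ n) (u₀ u₁ θ₀ : E n → ℂ) :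
    QuarticDecay (profileSymbol σ u₀ u₁ θ₀ t) ∧
    profile σ u₀ u₁ θ₀ t = 𝓕⁻ (profileSymbol σ u₀ u₁ θ₀ t) := by
  obtain ⟨h0, h1, hH⟩ := quarticDecay_symbols (n := n) hσ ht
  have he := radialSymbol_even (n := n) (symbolJ0 σ t)
  have d1 := h0.const_mul (meanP u₁)
  have d2s := fun i : Fin n ↦ (h0.coord_mul i).const_mul (momentM u₁ i)
  have d2 := QuarticDecay.sum Finset.univ d2s
  have d2' := d2.const_mul (-1)
  have d3 := hH.const_mul (meanP u₁ * ((t / (8 * σ ^ 2) : ℝ) : ℂ))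
  have d4 := h1.const_mul (meanP u₀)
  have d5 := h0.sq_mul.const_mul ((σ : ℂ)⁻¹ * meanP θ₀)
  have a1 := d1.add d2'
  have a2 := a1.add d3
  have a3 := a2.add d4
  refine ⟨a3.add d5, funext fun x ↦ ?_⟩
  have e : 𝓕⁻ (profileSymbol σ u₀ u₁ θ₀ t) x =
      meanP u₁ * 𝓕⁻ (radialSymbol n (symbolJ0 σ t)) x
      + (-1 : ℂ) * ∑ i, momentM u₁ i * 𝓕⁻ (fun x ↦ (2 * Real.pi * Complex.I * (x i : ℂ)) *
          radialSymbol n (symbolJ0 σ t) x) x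
      + (meanP u₁ * ((t / (8 * σ ^ 2) : ℝ) : ℂ)) * 𝓕⁻ (radialSymbol n (symbolH σ t)) x
      + meanP u₀ * 𝓕⁻ (radialSymbol n (symbolJ1 σ t)) x
      + ((σ : ℂ)⁻¹ * meanP θ₀) * 𝓕⁻ (fun x ↦ ((((2 * Real.pi * ‖x‖) ^ 2 : ℝ) : ℂ) *
          radialSymbol n (symbolJ0 σ t) x)) x := by
    unfold profileSymbol
    rw [fourierInv_add (a3.integrable hn) (d5.integrable hn),
      fourierInv_add (a2.integrable hn) (d4.integrable hn),
      fourierInv_add (a1.integrable hn) (d3.integrable hn),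
      fourierInv_add (d1.integrable hn) (d2'.integrable hn)]
    simp only [fourierInv_const_mul]
    rw [fourierInv_sum _ (fun i ↦ (d2s i).integrable hn)]
    simp only [fourierInv_const_mul]
  have eΔ : (Δ (J0 n σ t)) x = (-1 : ℂ) * 𝓕⁻ (fun x ↦ ((((2 * Real.pi * ‖x‖) ^ 2 : ℝ) : ℂ) *
      radialSymbol n (symbolJ0 σ t) x)) x := by
    rw [← fourierInv_const_mul]; exact h0.laplacian_fourierInv hn he x
  have eD : gradPair (J0 n σ t) (momentM u₁) x = ∑ i, momentM u₁ i *
      𝓕⁻ (fun x ↦ (2 * Real.pi * Complex.I * (x i : ℂ)) * radialSymbol n (symbolJ0 σ t) x) x := by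
    refine Finset.sum_congr rfl fun i _ ↦ ?_
    rw [mul_comm]
    exact congrArg _ (h0.fderiv_fourierInv hn he x i)
  rw [e, profile, eΔ, eD]
  have eJ0 : J0 n σ t x = 𝓕⁻ (radialSymbol n (symbolJ0 σ t)) x := rfl
  have eJ1 : J1 n σ t x = 𝓕⁻ (radialSymbol n (symbolJ1 σ t)) x := rfl
  have eH : H n σ t x = ((t / (8 * σ ^ 2) : ℝ) : ℂ) * 𝓕⁻ (radialSymbol n (symbolH σ t)) x := rfl
  rw [eJ0, eJ1, eH]
  ring

end ThermoPlate

/-! ### Size of the leading symbol, and the data near zero frequency. -/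

namespace ThermoPlate

variable {n : ℕ}

lemma rate_lower {σ ρ : ℝ} (hσ : 0 < σ) (hρ : 0 < ρ) :
    1 / (64 * (1 + σ)) * ρ ^ 2 ≤ rate σ ρ ∨ 1 / (64 * (1 + σ)) ≤ rate σ ρ := by
  rw [rate]
  rcases le_total ρ 1 with h | h
  · left
    rw [div_mul_eq_mul_div, one_mul]
    gcongr
  · right
    rw [div_le_div_iff₀ (by positivity) (by positivity)]
    nlinarith [mul_le_mul_of_nonneg_left h hσ.le, mul_le_mul_of_nonneg_left h hρ.le]

/-- Interpolates between `sin² y ≤ y²` and `sin² y ≤ 1`. With `y = r²t` it bounds `sin²(r²t)/r²` by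
`2t/(1 + r²t)`, which has no singularity at `r = 0`. -/
lemma sin_sq_le {y : ℝ} (hy : 0 ≤ y) : Real.sin y ^ 2 * (1 + y) ≤ 2 * y := by
  have h1 : Real.sin y ^ 2 ≤ 1 := Real.sin_sq_le_one y
  have h2 : Real.sin y ^ 2 ≤ y ^ 2 := sq_le_sq.2 Real.abs_sin_le_abs
  rcases le_total y 1 with h | h
  · nlinarith [sq_nonneg (Real.sin y)]
  · nlinarith

/-- The square of the leading symbol `|ξ| · Ĵ₀`. -/
lemma sq_mul_symbolJ0_le {σ t r : ℝ} (hσ : 0 < σ) (ht : 0 < t) (hr : 0 < r) :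
    (r * symbolJ0 σ t r) ^ 2 ≤ 2 * t / (1 + r ^ 2 * t) ∧
    (r * symbolJ0 σ t r) ^ 2 ≤ 1 / r ^ 2 * Real.exp (-(r ^ 4 * t / (2 * σ))) ^ 2 := by
  have e : (r * symbolJ0 σ t r) ^ 2 = Real.sin (r ^ 2 * t) ^ 2 / r ^ 2 *
      Real.exp (-(r ^ 4 * t / (2 * σ))) ^ 2 := by
    rw [symbolJ0]; field_simp
  have hexp : Real.exp (-(r ^ 4 * t / (2 * σ))) ^ 2 ≤ 1 := by
    apply pow_le_one₀ (Real.exp_pos _).le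
    rw [Real.exp_le_one_iff, neg_nonpos]
    positivity
  rw [e]
  constructor
  · refine (mul_le_of_le_one_right (by positivity) hexp).trans ?_
    rw [div_le_div_iff₀ (by positivity) (by positivity)]
    have := sin_sq_le (show 0 ≤ r ^ 2 * t by positivity)
    linarith
  · gcongr
    exact Real.sin_sq_le_one _

lemma measurable_symbolJ0 (σ t : ℝ) : Measurable (symbolJ0 σ t) := by
  unfold symbolJ0; fun_prop

lemma exists_leading_bound_one {σ : ℝ} (hσ : 0 < σ) : ∃ K : ℝ, 0 ≤ K ∧ ∀ t : ℝ, 2 ≤ t →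
    eLpNorm (fun x : E 1 ↦ 2 * Real.pi * ‖x‖ * symbolJ0 σ t (2 * Real.pi * ‖x‖)) 2 ≤
      ENNReal.ofReal (K * B 1 t) := by
  refine ⟨Real.sqrt (sphereArea 1 / 2), Real.sqrt_nonneg _, fun t ht ↦ ?_⟩
  have ht0 : 0 < t := by linarith
  have hst : 0 < Real.sqrt t := Real.sqrt_pos.2 ht0
  set a : ℝ := 2 * Real.pi * Real.sqrt t with ha
  have ha0 : 0 < a := by positivity
  set G : ℝ → ℝ := fun s ↦ 2 * t * (1 + (a * s) ^ 2)⁻¹ with hG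
  have hGi : Integrable G := ((integrable_inv_one_add_sq).comp_mul_left' ha0.ne').const_mul _
  -- An arctangent integral, `2t · (π/2)/(2π√t)`; its square root gives the rate `t^(1/4)`.
  have hGv : ∫ s in Set.Ioi (0 : ℝ), G s = Real.sqrt t / 2 := by
    rw [hG, integral_const_mul, integral_comp_mul_left_Ioi (fun s ↦ (1 + s ^ 2)⁻¹) 0 ha0, mul_zero,
      integral_Ioi_inv_one_add_sq, ha]
    have : t = Real.sqrt t * Real.sqrt t := (Real.mul_self_sqrt ht0.le).symm
    simp only [Real.arctan_zero, sub_zero, smul_eq_mul]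
    field_simp
    rw [Real.sq_sqrt ht0.le]
  have hle : ∀ s ∈ Set.Ioi (0 : ℝ),
      s ^ (1 - 1) * (2 * Real.pi * s * symbolJ0 σ t (2 * Real.pi * s)) ^ 2 ≤ G s := fun s hs ↦ by
    have hs0 : (0 : ℝ) < s := hs
    have h := (sq_mul_symbolJ0_le hσ ht0 (show 0 < 2 * Real.pi * s by positivity)).1
    rw [Nat.sub_self, pow_zero, one_mul]
    refine h.trans (le_of_eq ?_)
    rw [hG, ha]
    simp only
    rw [div_eq_mul_inv, show (2 * Real.pi * Real.sqrt t * s) ^ 2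
      = (2 * Real.pi * s) ^ 2 * Real.sqrt t ^ 2 by ring, Real.sq_sqrt ht0.le]
  have hm : Measurable fun s : ℝ ↦ 2 * Real.pi * s * symbolJ0 σ t (2 * Real.pi * s) := by
    have := measurable_symbolJ0 σ t
    fun_prop
  have hi : IntegrableOn (fun s : ℝ ↦ s ^ (1 - 1) *
      (2 * Real.pi * s * symbolJ0 σ t (2 * Real.pi * s)) ^ 2) (Set.Ioi 0) := by
    refine hGi.integrableOn.mono' (by fun_prop) ?_
    filter_upwards [ae_restrict_mem measurableSet_Ioi] with s hs
    have hs0 : (0 : ℝ) < s := hs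
    rw [Real.norm_eq_abs, abs_of_nonneg (by positivity)]
    exact hle s hs
  have hK := (setIntegral_mono_on hi hGi.integrableOn measurableSet_Ioi hle).trans hGv.le
  refine (eLpNorm_radial_le le_rfl
    (f := fun s ↦ 2 * Real.pi * s * symbolJ0 σ t (2 * Real.pi * s)) hm hi hK).2.trans (le_of_eq ?_)
  congr 1
  rw [B, if_pos rfl, show sphereArea 1 * (Real.sqrt t / 2) = sphereArea 1 / 2 * Real.sqrt t by ring,
    Real.sqrt_mul (by have := sphereArea_nonneg 1; positivity), Real.sqrt_eq_rpow (Real.sqrt t),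
    Real.sqrt_eq_rpow t, ← Real.rpow_mul ht0.le]
  norm_num

lemma exists_leading_bound_two {σ : ℝ} (hσ : 0 < σ) : ∃ K : ℝ, 0 ≤ K ∧ ∀ t : ℝ, 2 ≤ t →
    eLpNorm (fun x : E 2 ↦ 2 * Real.pi * ‖x‖ * symbolJ0 σ t (2 * Real.pi * ‖x‖)) 2 ≤
      ENNReal.ofReal (K * B 2 t) := by
  set a : ℝ := (2 * Real.pi) ^ 2 with ha
  have ha0 : 0 < a := by positivity
  have ha1 : 1 ≤ a := by
    have := Real.pi_gt_three
    rw [ha]; nlinarith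
  have hl2 : 0 < Real.log 2 := Real.log_pos (by norm_num)
  -- The additive constants `log(1+a)` and `σ` are converted into multiples of `log t` by `log t ≥
  -- log 2`, which is where `t ≥ 2` enters.
  set D : ℝ := Real.log (1 + a) / Real.log 2 + 1 + σ / Real.log 2 with hD
  have hla : 0 < Real.log (1 + a) := Real.log_pos (by linarith)
  have hD0 : 0 < D := by positivity
  refine ⟨Real.sqrt (sphereArea 2 * D), Real.sqrt_nonneg _, fun t ht ↦ ?_⟩
  have ht0 : 0 < t := by linarith
  have hlt : Real.log 2 ≤ Real.log t := Real.log_le_log (by norm_num) ht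
  set G₁ : ℝ → ℝ := fun s ↦ 2 * t * s / (1 + a * t * s ^ 2) with hG₁
  set b : ℝ := a ^ 2 * t / σ with hb
  have hb0 : 0 < b := by positivity
  -- For `s > 1` the exponential is kept and `1/(as) ≤ s³`. The power `3` makes the integral
  -- explicit, `1/(4b)`, while `G₁` on `(0, 1]` supplies the logarithm.
  set G₂ : ℝ → ℝ := fun s ↦ s ^ (3 : ℝ) * Real.exp (-b * s ^ 4) with hG₂
  have hG₁d : ∀ s, HasDerivAt (fun s ↦ Real.log (1 + a * t * s ^ 2) / a) (G₁ s) s := fun s ↦ by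
    have hp : 1 + a * t * s ^ 2 ≠ 0 := by positivity
    have := (((((hasDerivAt_pow 2 s).const_mul (a * t)).const_add 1).log hp).div_const a)
    refine this.congr_deriv ?_
    simp only [hG₁]
    field_simp
    ring
  have hG₁c : Continuous G₁ := by
    refine Continuous.div (by fun_prop) (by fun_prop) fun s ↦ by positivity
  have hG₁v : ∫ s in Set.Ioc (0 : ℝ) 1, G₁ s = Real.log (1 + a * t) / a := by
    rw [← intervalIntegral.integral_of_le zero_le_one,
      intervalIntegral.integral_eq_sub_of_hasDerivAt (fun s _ ↦ hG₁d s)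
        (hG₁c.intervalIntegrable _ _)]
    simp
  have hG₁i : IntegrableOn G₁ (Set.Ioc 0 1) :=
    (hG₁c.integrableOn_Icc).mono_set Set.Ioc_subset_Icc_self
  have hG₂i : IntegrableOn G₂ (Set.Ioi 0) := integrableOn_pow_mul_exp_quartic (by norm_num) hb0
  have hG₂v : ∫ s in Set.Ioi (0 : ℝ), G₂ s ≤ σ := by
    rw [hG₂, integral_pow_mul_exp_quartic (by norm_num) hb0]
    norm_num
    rw [Real.rpow_neg_one, hb, inv_div]
    rw [mul_one_div, div_div, div_le_iff₀ (by positivity)]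
    have : 1 ≤ a ^ 2 * t * 4 := by nlinarith [one_le_pow₀ ha1 (n := 2)]
    nlinarith
  have hind : IntegrableOn ((Set.Ioc 0 1).indicator G₁) (Set.Ioi 0) :=
    ((integrable_indicator_iff measurableSet_Ioc).2 hG₁i).integrableOn
  set G : ℝ → ℝ := fun s ↦ (Set.Ioc 0 1).indicator G₁ s + G₂ s with hG
  have hGi : IntegrableOn G (Set.Ioi 0) := hind.add hG₂i
  have hGv : ∫ s in Set.Ioi (0 : ℝ), G s ≤ D * Real.log t := by
    rw [hG, integral_add hind hG₂i, setIntegral_indicator measurableSet_Ioc,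
      Set.inter_eq_self_of_subset_right Set.Ioc_subset_Ioi_self, hG₁v]
    have h1 : Real.log (1 + a * t) ≤ Real.log (1 + a) + Real.log t := by
      rw [← Real.log_mul (by positivity) (by positivity)]
      exact Real.log_le_log (by positivity) (by nlinarith)
    have h2 : Real.log (1 + a * t) / a ≤ Real.log (1 + a) + Real.log t :=
      (div_le_self (Real.log_nonneg (by nlinarith)) ha1).trans h1
    have h3 : ∀ z, 0 ≤ z → z ≤ z / Real.log 2 * Real.log t := fun z hz ↦ by
      rw [div_mul_eq_mul_div, le_div_iff₀ hl2]
      gcongr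
    have h4 := h3 _ hla.le
    have h5 := h3 _ hσ.le
    rw [hD]
    linarith
  have hle : ∀ s ∈ Set.Ioi (0 : ℝ),
      s ^ (2 - 1) * (2 * Real.pi * s * symbolJ0 σ t (2 * Real.pi * s)) ^ 2 ≤ G s := fun s hs ↦ by
    have hs0 : (0 : ℝ) < s := hs
    obtain ⟨h1, h2⟩ := sq_mul_symbolJ0_le hσ ht0 (show 0 < 2 * Real.pi * s by positivity)
    have hG₂0 : 0 ≤ G₂ s := by simp only [hG₂]; positivity
    simp only [hG]
    norm_num only [pow_one]
    rcases le_or_gt s 1 with hs1 | hs1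
    · rw [Set.indicator_of_mem (show s ∈ Set.Ioc (0 : ℝ) 1 from ⟨hs0, hs1⟩)]
      calc _ ≤ s * (2 * t / (1 + (2 * Real.pi * s) ^ 2 * t)) := by gcongr
        _ = G₁ s := by simp only [hG₁, ha]; ring
        _ ≤ _ := le_add_of_nonneg_right hG₂0
    · rw [Set.indicator_of_notMem (fun h : s ∈ Set.Ioc (0 : ℝ) 1 ↦ absurd h.2 hs1.not_ge), zero_add]
      calc _ ≤ s * (1 / (2 * Real.pi * s) ^ 2 *
            Real.exp (-((2 * Real.pi * s) ^ 4 * t / (2 * σ))) ^ 2) := by gcongr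
        _ = 1 / (a * s) * Real.exp (-b * s ^ 4) := by
          rw [← Real.exp_nat_mul, hb, ha]
          rw [show ((2 : ℕ) : ℝ) * -((2 * Real.pi * s) ^ 4 * t / (2 * σ))
            = -(((2 * Real.pi) ^ 2) ^ 2 * t / σ) * s ^ 4 by push_cast; field_simp]
          field_simp
        _ ≤ s ^ (3 : ℝ) * Real.exp (-b * s ^ 4) := by
          gcongr
          rw [div_le_iff₀ (by positivity)]
          have h3 : (1 : ℝ) ≤ s ^ (3 : ℝ) := Real.one_le_rpow hs1.le (by norm_num)
          have h4 : 1 ≤ a * s := by nlinarith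
          nlinarith
  have hm : Measurable fun s : ℝ ↦ 2 * Real.pi * s * symbolJ0 σ t (2 * Real.pi * s) := by
    have := measurable_symbolJ0 σ t
    fun_prop
  have hi : IntegrableOn (fun s : ℝ ↦ s ^ (2 - 1) *
      (2 * Real.pi * s * symbolJ0 σ t (2 * Real.pi * s)) ^ 2) (Set.Ioi 0) := by
    refine hGi.mono' (by fun_prop) ?_
    filter_upwards [ae_restrict_mem measurableSet_Ioi] with s hs
    have hs0 : (0 : ℝ) < s := hs
    rw [Real.norm_eq_abs, abs_of_nonneg (by positivity)]
    exact hle s hs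
  have hK := (setIntegral_mono_on hi hGi measurableSet_Ioi hle).trans hGv
  refine (eLpNorm_radial_le (by norm_num)
    (f := fun s ↦ 2 * Real.pi * s * symbolJ0 σ t (2 * Real.pi * s)) hm hi hK).2.trans (le_of_eq ?_)
  congr 1
  rw [B, if_neg (by norm_num), if_pos rfl, ← mul_assoc,
    Real.sqrt_mul (mul_nonneg (sphereArea_nonneg 2) hD0.le)]

lemma exists_leading_bound_three (hn : 3 ≤ n) {σ : ℝ} (hσ : 0 < σ) :
    ∃ K : ℝ, 0 ≤ K ∧ ∀ t : ℝ, 2 ≤ t →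
    eLpNorm (fun x : E n ↦ 2 * Real.pi * ‖x‖ * symbolJ0 σ t (2 * Real.pi * ‖x‖)) 2 ≤
      ENNReal.ofReal (K * B n t) := by
  have hn' : (3 : ℝ) ≤ n := by exact_mod_cast hn
  have hc : 0 < (2 * Real.pi) ^ 4 / (2 * σ) := by positivity
  -- Here `|sin| ≤ 1` suffices: `1/r` is locally square integrable once `n - 2 > 0`.
  obtain ⟨K, hK0, hK⟩ := exists_eLpNorm_quartic_le (n := n) (by omega) (q := -1) (by linarith) hc
  refine ⟨K, hK0, fun t ht ↦ ?_⟩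
  have ht0 : 0 < t := by linarith
  have hB : B n t = t ^ (-(n + 2 * (-1 : ℝ)) / 8) := by
    rw [B, if_neg (by omega), if_neg (by omega)]
    congr 1; ring
  rw [hB]
  refine le_trans (eLpNorm_mono_real fun x ↦ ?_) (hK t ht0).2
  rcases eq_or_ne x 0 with rfl | hx
  · simp [Real.zero_rpow]
  have hx0 : 0 < ‖x‖ := norm_pos_iff.2 hx
  have h := (sq_mul_symbolJ0_le hσ ht0 (show 0 < 2 * Real.pi * ‖x‖ by positivity)).2
  rw [← one_div_pow, ← mul_pow] at h
  refine (abs_le_of_sq_le_sq h (by positivity)).trans ?_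
  rw [Real.rpow_neg_one, show (2 * Real.pi * ‖x‖) ^ 4 * t / (2 * σ)
    = (2 * Real.pi) ^ 4 / (2 * σ) * t * ‖x‖ ^ 4 by ring, ← one_div]
  gcongr
  have := Real.pi_gt_three
  nlinarith

lemma exists_leading_bound (hn : 1 ≤ n) {σ : ℝ} (hσ : 0 < σ) :
    ∃ K : ℝ, 0 ≤ K ∧ ∀ t : ℝ, 2 ≤ t →
    eLpNorm (fun x : E n ↦ 2 * Real.pi * ‖x‖ * symbolJ0 σ t (2 * Real.pi * ‖x‖)) 2 ≤
      ENNReal.ofReal (K * B n t) := by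
  rcases (show n = 1 ∨ n = 2 ∨ 3 ≤ n by omega) with rfl | rfl | h
  · exact exists_leading_bound_one hσ
  · exact exists_leading_bound_two hσ
  · exact exists_leading_bound_three h hσ

/-- First-order expansion at zero frequency of the Fourier transform of an `L^{1,1}` function. -/
lemma exists_fourier_expansion {f : E n → ℂ} (hf : MemL11 f) {δ : ℝ} (hδ : 0 < δ) :
    ∃ C : ℝ, 0 ≤ C ∧ ∀ y : E n,
      ‖𝓕 f y - meanP f + ∑ i, momentM f i * (2 * Real.pi * Complex.I * (y i : ℂ))‖ ≤
        δ * ‖y‖ + C * ‖y‖ ^ 2 := by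
  have h1 : Integrable fun v ↦ ‖v‖ * ‖f v‖ := by
    refine hf.2.mono' (by have := hf.1.1; fun_prop) (ae_of_all _ fun x ↦ ?_)
    rw [norm_mul, norm_norm, norm_norm]
    gcongr
    linarith
  have h2 : Integrable (VectorFourier.fourierSMulRight (innerSL ℝ) f) := by
    have hm := hf.1.1.fourierSMulRight (L := innerSL ℝ)
    refine (h1.const_mul (2 * Real.pi)).mono' hm (ae_of_all _ fun v ↦ ?_)
    rw [VectorFourier.norm_fourierSMulRight, innerSL_apply_norm]
    exact (mul_assoc _ _ _).le
  set D := 𝓕 (VectorFourier.fourierSMulRight (innerSL ℝ) f) 0 with hD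
  have hder : HasFDerivAt (𝓕 f) D 0 := Real.hasFDerivAt_fourier hf.1 h1 0
  have hP : 𝓕 f 0 = meanP f := by simp [Real.fourier_eq, meanP]
  have hDe : ∀ i, D (EuclideanSpace.single i 1) = -(2 * Real.pi * Complex.I) * momentM f i := by
    intro i
    rw [hD, Real.fourier_continuousLinearMap_apply h2, Real.fourier_eq]
    simp only [inner_zero_right, neg_zero, AddChar.map_zero_eq_one, one_smul,
      fourierSMulRight_single]
    rw [integral_const_mul]
    rfl
  have hDy : ∀ y : E n, D y = -∑ i, momentM f i * (2 * Real.pi * Complex.I * (y i : ℂ)) := fun y ↦ by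
    have hy : y = ∑ i, y i • EuclideanSpace.single i (1 : ℝ) := by
      simpa using ((EuclideanSpace.basisFun (Fin n) ℝ).sum_repr y).symm
    conv_lhs => rw [hy]
    rw [map_sum, ← Finset.sum_neg_distrib]
    refine Finset.sum_congr rfl fun i _ ↦ ?_
    rw [map_smul, hDe, Complex.real_smul]
    ring
  have heq : ∀ y : E n, 𝓕 f y - meanP f + ∑ i, momentM f i * (2 * Real.pi * Complex.I * (y i : ℂ))
      = 𝓕 f y - 𝓕 f 0 - D (y - 0) := fun y ↦ by rw [hP, sub_zero, hDy]; ring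
  -- Differentiability gives `δ‖y‖` only in a ball of radius `ε`. Outside it `‖y‖/ε ≥ 1`, so the
  -- constant and linear bounds are dominated by a multiple of `‖y‖²`.
  have hlo := hder.isLittleO.def hδ
  rw [Metric.eventually_nhds_iff] at hlo
  obtain ⟨ε, hε, hball⟩ := hlo
  set S : ℝ := ∫ x, ‖f x‖ with hS
  have hS0 : 0 ≤ S := integral_nonneg fun _ ↦ norm_nonneg _
  have hFb : ∀ y, ‖𝓕 f y‖ ≤ S := fun y ↦
    VectorFourier.norm_fourierIntegral_le_integral_norm _ _ _ _ _
  refine ⟨2 * S / ε ^ 2 + ‖D‖ / ε, by positivity, fun y ↦ ?_⟩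
  rw [heq]
  rcases lt_or_ge ‖y‖ ε with hy | hy
  · have := hball (y := y) (by simpa using hy)
    rw [sub_zero] at this ⊢
    exact this.trans (le_add_of_nonneg_right (by positivity))
  · have h3 : ‖𝓕 f y - 𝓕 f 0 - D (y - 0)‖ ≤ S + S + ‖D‖ * ‖y‖ := by
      rw [sub_zero]
      exact (norm_sub_le _ _).trans (add_le_add ((norm_sub_le _ _).trans
        (add_le_add (hFb y) (hFb 0))) (D.le_opNorm y))
    have h4 : 1 ≤ ‖y‖ / ε := by rwa [one_le_div hε]
    have h5 : S + S ≤ 2 * S / ε ^ 2 * ‖y‖ ^ 2 := by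
      have : 2 * S / ε ^ 2 * ‖y‖ ^ 2 = 2 * S * (‖y‖ / ε) ^ 2 := by field_simp
      rw [this]
      nlinarith [one_le_pow₀ h4 (n := 2)]
    have h6 : ‖D‖ * ‖y‖ ≤ ‖D‖ / ε * ‖y‖ ^ 2 := by
      have : ‖D‖ / ε * ‖y‖ ^ 2 = ‖D‖ * ‖y‖ * (‖y‖ / ε) := by field_simp
      rw [this]
      exact le_mul_of_one_le_right (by positivity) h4
    have h7 : 0 ≤ δ * ‖y‖ := by positivity
    linarith

end ThermoPlate

/-! ### Comparison in Fourier space and conclusion. -/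

namespace ThermoPlate

variable {n : ℕ}

/-- A uniform lower bound of the decay rates, in units of `|η|⁴` at low frequency. -/
noncomputable def minRate (σ : ℝ) : ℝ := min (1 / (64 * (1 + σ))) (1 / (4 * σ))

lemma minRate_pos {σ : ℝ} (hσ : 0 < σ) : 0 < minRate σ := by unfold minRate; positivity

lemma pow_four_le (s : ℝ) : s ^ 4 ≤ (2 * Real.pi * s) ^ 4 := by
  have h : (1 : ℝ) ≤ (2 * Real.pi) ^ 4 := one_le_pow₀ (by linarith [Real.pi_gt_three])
  rw [mul_pow]
  exact le_mul_of_one_le_left (by positivity) h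

/-- Adding the low- and high-frequency bounds replaces a splitting of the frequency domain: the
first summand is square integrable in `ξ`, the second is uniformly small in time. -/
lemma exp_rate_le {σ t s : ℝ} (hσ : 0 < σ) (ht : 0 < t) (hs : 0 < s) :
    Real.exp (-(rate σ ((2 * Real.pi * s) ^ 2) * t)) ≤
      Real.exp (-(minRate σ * t * s ^ 4)) + Real.exp (-(minRate σ * t)) := by
  have hc : minRate σ ≤ 1 / (64 * (1 + σ)) := min_le_left _ _
  have hc0 := minRate_pos hσ
  rcases rate_lower hσ (show 0 < (2 * Real.pi * s) ^ 2 by positivity) with h | h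
  · refine le_trans ?_ (le_add_of_nonneg_right (Real.exp_pos _).le)
    rw [Real.exp_le_exp, neg_le_neg_iff]
    have h1 : minRate σ * s ^ 4 ≤ rate σ ((2 * Real.pi * s) ^ 2) := by
      refine le_trans ?_ h
      rw [← pow_mul]
      exact mul_le_mul hc (pow_four_le s) (by positivity) (by positivity)
    nlinarith
  · refine le_trans ?_ (le_add_of_nonneg_left (Real.exp_pos _).le)
    rw [Real.exp_le_exp, neg_le_neg_iff]
    exact mul_le_mul_of_nonneg_right (hc.trans h) ht.le

lemma exp_quartic_le {σ t b : ℝ} (ht : 0 < t) (hb0 : 0 < b) (hb : b ≤ 4 * σ) (s : ℝ) :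
    Real.exp (-((2 * Real.pi * s) ^ 4 * t / b)) ≤ Real.exp (-(minRate σ * t * s ^ 4)) := by
  rw [Real.exp_le_exp, neg_le_neg_iff]
  have h1 : minRate σ ≤ 1 / b := (min_le_right _ _).trans (by gcongr)
  have h2 := mul_le_mul h1 (pow_four_le s) (by positivity) (by positivity)
  calc minRate σ * t * s ^ 4 = t * (minRate σ * s ^ 4) := by ring
    _ ≤ t * (1 / b * (2 * Real.pi * s) ^ 4) := by gcongr
    _ = _ := by ring

lemma fourier_Lp_ae_eq {f : L2 n} (hf : MemL11 f) : (𝓕 f : L2 n) =ᵐ[volume] 𝓕 (f : E n → ℂ) := by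
  have h := fourier_toLp_ae_eq hf.1 (Lp.memLp f)
  rwa [Lp.toLp_coeFn] at h

set_option maxHeartbeats 1000000 in
/-- Pointwise comparison of the solution and the profile in Fourier space. -/
lemma exists_symbol_bound (hn : 1 ≤ n) {σ : ℝ} (hσ : 0 < σ) {u₀ u₁ θ₀ : L2 n} (hu₀ : MemL11 u₀)
    (hu₁ : MemL11 u₁) (hθ₀ : MemL11 θ₀) {u : ℝ → L2 n} {θ : ℝ → 𝓢'(E n, ℂ)}
    (hsol : IsSolution σ u₀ u₁ θ₀ u θ) {δ : ℝ} (hδ : 0 < δ) :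
    ∃ A K : ℝ, 0 ≤ A ∧ 0 ≤ K ∧ ∀ t : ℝ, 0 < t → ∀ᵐ x,
      ‖(𝓕 (u t) : L2 n) x - profileSymbol σ u₀ u₁ θ₀ t x‖ ≤
        δ * ‖2 * Real.pi * ‖x‖ * symbolJ0 σ t (2 * Real.pi * ‖x‖)‖
        + A * Real.exp (-(minRate σ * t * ‖x‖ ^ 4))
        + K * Real.exp (-(minRate σ * t)) *
          (‖(𝓕 u₀ : L2 n) x‖ + ‖(𝓕 u₁ : L2 n) x‖ + ‖(𝓕 θ₀ : L2 n) x‖) := by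
  obtain ⟨K, hK0, hK⟩ := exists_kernel_bound hσ
  obtain ⟨C, hC0, hC⟩ := exists_fourier_expansion hu₁ hδ
  set S : ℝ := (∫ x, ‖u₀ x‖) + (∫ x, ‖u₁ x‖) + ∫ x, ‖θ₀ x‖ with hS
  have hS0 : 0 ≤ S := by positivity
  set D : ℝ := ‖meanP u₁‖ * ((2 * σ + 5) / (2 * σ)) + ‖meanP u₀‖ + σ⁻¹ * ‖meanP θ₀‖ with hD
  have hD0 : 0 ≤ D := by positivity
  refine ⟨K * S + C + D, K, by positivity, hK0.le, fun t ht ↦ ?_⟩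
  have : NeZero n := ⟨by omega⟩
  filter_upwards [fourier_solution hsol ht.le, fourier_Lp_ae_eq hu₀, fourier_Lp_ae_eq hu₁,
    fourier_Lp_ae_eq hθ₀, Measure.ae_ne volume (0 : E n)] with x hx e0 e1 e2 hx0
  have hs : 0 < ‖x‖ := norm_pos_iff.2 hx0
  set s := ‖x‖ with hsdef
  obtain ⟨ka, kc, kb⟩ := hK ((2 * Real.pi * s) ^ 2) t (by positivity) ht.le
  set Q := Real.exp (-(minRate σ * t * s ^ 4)) with hQ
  set Et := Real.exp (-(minRate σ * t)) with hEt
  have hQ0 : 0 < Q := Real.exp_pos _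
  have hE0 : 0 < Et := Real.exp_pos _
  have hQE := exp_rate_le hσ ht hs
  set m0 := symbolJ0 σ t (2 * Real.pi * s) with hm0
  have hm0' : Real.sin ((2 * Real.pi * s) ^ 2 * t) / (2 * Real.pi * s) ^ 2 *
      Real.exp (-(((2 * Real.pi * s) ^ 2) ^ 2 * t / (2 * σ))) = m0 := by
    rw [hm0, symbolJ0, ← pow_mul]
  rw [hm0'] at kb
  set U0 := (𝓕 u₀ : L2 n) x with hU0
  set U1 := (𝓕 u₁ : L2 n) x with hU1
  set U2 := (𝓕 θ₀ : L2 n) x with hU2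
  -- The transforms are bounded by the `L¹` norms of the data; this is used where the factor `Q`
  -- already gives square integrability.
  have hGS : ‖U0‖ + ‖U1‖ + ‖U2‖ ≤ S := by
    rw [e0, e1, e2]
    refine add_le_add (add_le_add ?_ ?_) ?_ <;>
      exact VectorFourier.norm_fourierIntegral_le_integral_norm _ _ _ _ _
  have hexp2 := exp_quartic_le (σ := σ) ht (b := 2 * σ) (by positivity) (by linarith) s
  have hexp4 := exp_quartic_le (σ := σ) ht (b := 4 * σ) (by positivity) le_rfl s
  have hm0sq : (2 * Real.pi * s) ^ 2 * |m0| ≤ Q := by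
    refine le_trans ?_ hexp2
    rw [hm0, symbolJ0, abs_mul, abs_div, abs_of_pos (show 0 < (2 * Real.pi * s) ^ 2 by positivity),
      Real.abs_exp]
    calc _ = |Real.sin ((2 * Real.pi * s) ^ 2 * t)|
          * Real.exp (-((2 * Real.pi * s) ^ 4 * t / (2 * σ))) := by field_simp
      _ ≤ _ := mul_le_of_le_one_left (Real.exp_pos _).le (Real.abs_sin_le_one _)
  have hm1 := (abs_symbolJ1_le σ t (2 * Real.pi * s)).trans hexp2
  have hmH : t / (8 * σ ^ 2) * |symbolH σ t (2 * Real.pi * s)| ≤ (2 * σ + 5) / (2 * σ) * Q :=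
    (abs_symbolH_le hσ ht _).trans (by gcongr)
  have hpi : 1 ≤ 2 * Real.pi := by linarith [Real.pi_gt_three]
  have hexpn := hC x
  rw [← e1] at hexpn
  set Z : ℂ := U1 - meanP u₁ + ∑ i, momentM u₁ i * (2 * Real.pi * Complex.I * (x i : ℂ)) with hZ
  -- Replacing `k₁` by `m0` and subtracting the mean and gradient terms of the profile leaves `m0 *
  -- Z`; every other term is estimated separately, without cancellation.
  have hid : (𝓕 (u t) : L2 n) x - profileSymbol σ u₀ u₁ θ₀ t x =
      (kernel σ t ((2 * Real.pi * s) ^ 2) 0 : ℂ) * U0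
      + ((kernel σ t ((2 * Real.pi * s) ^ 2) 1 - m0 : ℝ) : ℂ) * U1
      + (kernel σ t ((2 * Real.pi * s) ^ 2) 2 : ℂ) * U2
      + (m0 : ℂ) * Z
      - meanP u₁ * ((t / (8 * σ ^ 2) * symbolH σ t (2 * Real.pi * s) : ℝ) : ℂ)
      - meanP u₀ * (symbolJ1 σ t (2 * Real.pi * s) : ℂ)
      - (σ : ℂ)⁻¹ * meanP θ₀ * (((2 * Real.pi * s) ^ 2 * m0 : ℝ) : ℂ) := by
    rw [hx, profileSymbol]
    simp only [radialSymbol, ← hsdef, ← hm0, hZ, ← mul_assoc]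
    rw [← Finset.sum_mul]
    push_cast
    ring
  have t1 : ‖(kernel σ t ((2 * Real.pi * s) ^ 2) 0 : ℂ) * U0‖ ≤ K * (Q + Et) * ‖U0‖ := by
    rw [norm_mul, Complex.norm_real]
    gcongr
    exact ka.trans (by gcongr)
  have t2 : ‖((kernel σ t ((2 * Real.pi * s) ^ 2) 1 - m0 : ℝ) : ℂ) * U1‖ ≤
      K * (Q + Et) * ‖U1‖ := by
    rw [norm_mul, Complex.norm_real]
    gcongr
    exact kb.trans (by gcongr)
  have t3 : ‖(kernel σ t ((2 * Real.pi * s) ^ 2) 2 : ℂ) * U2‖ ≤ K * (Q + Et) * ‖U2‖ := by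
    rw [norm_mul, Complex.norm_real]
    gcongr
    exact kc.trans (by gcongr)
  have t4 : ‖(m0 : ℂ) * Z‖ ≤ δ * ‖2 * Real.pi * s * m0‖ + C * Q := by
    rw [norm_mul, Complex.norm_real, Real.norm_eq_abs, Real.norm_eq_abs, abs_mul,
      abs_of_pos (show 0 < 2 * Real.pi * s by positivity)]
    have h1 : |m0| * s ≤ 2 * Real.pi * s * |m0| := by
      nlinarith [abs_nonneg m0, mul_nonneg hs.le (abs_nonneg m0)]
    have h2 : |m0| * s ^ 2 ≤ Q := by
      refine le_trans ?_ hm0sq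
      have : s ^ 2 ≤ (2 * Real.pi * s) ^ 2 := by
        gcongr; nlinarith
      nlinarith [abs_nonneg m0]
    calc |m0| * ‖Z‖ ≤ |m0| * (δ * s + C * s ^ 2) := by gcongr
      _ = δ * (|m0| * s) + C * (|m0| * s ^ 2) := by ring
      _ ≤ _ := by gcongr
  have t5 : ‖meanP u₁ * ((t / (8 * σ ^ 2) * symbolH σ t (2 * Real.pi * s) : ℝ) : ℂ)‖ ≤
      ‖meanP u₁‖ * ((2 * σ + 5) / (2 * σ)) * Q := by
    rw [norm_mul, Complex.norm_real, Real.norm_eq_abs, abs_mul,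
      abs_of_pos (show 0 < t / (8 * σ ^ 2) by positivity), mul_assoc ‖meanP u₁‖]
    exact mul_le_mul_of_nonneg_left hmH (norm_nonneg _)
  have t6 : ‖meanP u₀ * (symbolJ1 σ t (2 * Real.pi * s) : ℂ)‖ ≤ ‖meanP u₀‖ * Q := by
    rw [norm_mul, Complex.norm_real, Real.norm_eq_abs]
    gcongr
  have t7 : ‖(σ : ℂ)⁻¹ * meanP θ₀ * (((2 * Real.pi * s) ^ 2 * m0 : ℝ) : ℂ)‖ ≤
      σ⁻¹ * ‖meanP θ₀‖ * Q := by
    rw [norm_mul, norm_mul, Complex.norm_real, norm_inv, Complex.norm_real, Real.norm_eq_abs,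
      Real.norm_eq_abs, abs_mul, abs_of_pos hσ, abs_of_pos (show 0 < (2 * Real.pi * s) ^ 2 by positivity)]
    gcongr
  rw [hid]
  have htri := (norm_sub_le_of_le (norm_sub_le_of_le (norm_sub_le_of_le (norm_add_le_of_le
    (norm_add_le_of_le (norm_add_le_of_le t1 t2) t3) t4) t5) t6) t7)
  refine htri.trans ?_
  have hKQ : K * Q * (‖U0‖ + ‖U1‖ + ‖U2‖) ≤ K * Q * S := by gcongr
  rw [hD]
  linarith

lemma eLpNorm_triangle_real {f g h : E n → ℝ} (hf : AEStronglyMeasurable f volume)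
    (hg : AEStronglyMeasurable g volume) (hh : AEStronglyMeasurable h volume) {a b c F G H' : ℝ}
    (ha : 0 ≤ a) (hb : 0 ≤ b) (hc : 0 ≤ c) (hF0 : 0 ≤ F) (hG0 : 0 ≤ G) (hH0 : 0 ≤ H')
    (hF : eLpNorm f 2 ≤ ENNReal.ofReal F) (hG : eLpNorm g 2 ≤ ENNReal.ofReal G)
    (hH : eLpNorm h 2 ≤ ENNReal.ofReal H') :
    eLpNorm (fun x ↦ a * f x + b * g x + c * h x) 2 ≤ ENNReal.ofReal (a * F + b * G + c * H') := by
  have key : ∀ {a F : ℝ} {f : E n → ℝ}, 0 ≤ a → eLpNorm f 2 ≤ ENNReal.ofReal F →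
      eLpNorm (a • f) 2 ≤ ENNReal.ofReal (a * F) := fun {a F f} ha hF ↦ by
    rw [eLpNorm_const_smul, Real.enorm_of_nonneg ha, ENNReal.ofReal_mul ha]
    gcongr
  have h1 := eLpNorm_add_le ((hf.const_smul a).add (hg.const_smul b)) (hh.const_smul c)
    (p := 2) (by norm_num)
  have h2 := eLpNorm_add_le (hf.const_smul a) (hg.const_smul b) (p := 2) (by norm_num)
  refine h1.trans ?_
  rw [ENNReal.ofReal_add (by positivity) (by positivity),
    ENNReal.ofReal_add (by positivity) (by positivity)]
  exact add_le_add (h2.trans (add_le_add (key ha hF) (key hb hG))) (key hc hH)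

lemma B_nonneg (n : ℕ) {t : ℝ} (ht : 0 ≤ t) : 0 ≤ B n t := by
  unfold B; split_ifs <;> positivity

/-- `L` is chosen before `δ`, while `A` and `K` may depend on it: only the coefficient of `B n t`
has to become small, since the other terms are already `o(B n)`. -/
lemma exists_norm_bound (hn : 1 ≤ n) {σ : ℝ} (hσ : 0 < σ) {u₀ u₁ θ₀ : L2 n} (hu₀ : MemL11 u₀)
    (hu₁ : MemL11 u₁) (hθ₀ : MemL11 θ₀) {u : ℝ → L2 n} {θ : ℝ → 𝓢'(E n, ℂ)}
    (hsol : IsSolution σ u₀ u₁ θ₀ u θ) : ∃ L : ℝ, 0 ≤ L ∧ ∀ δ : ℝ, 0 < δ →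
    ∃ A K : ℝ, ∀ t : ℝ, 2 ≤ t →
      (eLpNorm (fun x ↦ u t x - profile σ u₀ u₁ θ₀ t x) 2).toReal ≤
        δ * (L * B n t) + (A * t ^ (-(n : ℝ) / 8) + K * Real.exp (-minRate σ * t)) := by
  obtain ⟨L, hL0, hL⟩ := exists_leading_bound hn hσ
  obtain ⟨M, hM0, hM⟩ := exists_eLpNorm_quartic_le hn (q := 0)
    (by have : (1 : ℝ) ≤ n := by exact_mod_cast hn
        linarith) (minRate_pos hσ)
  refine ⟨L, hL0, fun δ hδ ↦ ?_⟩
  obtain ⟨A, K, hA, hK, hAK⟩ := exists_symbol_bound hn hσ hu₀ hu₁ hθ₀ hsol hδ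
  set G : E n → ℝ := fun x ↦ ‖(𝓕 u₀ : L2 n) x‖ + ‖(𝓕 u₁ : L2 n) x‖ + ‖(𝓕 θ₀ : L2 n) x‖ with hG
  have hGm : MemLp G 2 := ((Lp.memLp (𝓕 u₀ : L2 n)).norm.add (Lp.memLp (𝓕 u₁ : L2 n)).norm).add
    (Lp.memLp (𝓕 θ₀ : L2 n)).norm
  refine ⟨A * M, K * (eLpNorm G 2).toReal, fun t ht ↦ ?_⟩
  have ht0 : 0 < t := by linarith
  obtain ⟨hdec, hprof⟩ := profileSymbol_spec hσ ht0 hn u₀ u₁ θ₀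
  obtain ⟨hQm, hQ⟩ := hM t ht0
  have hB := B_nonneg n ht0.le
  have hmeas : Measurable fun x : E n ↦ 2 * Real.pi * ‖x‖ * symbolJ0 σ t (2 * Real.pi * ‖x‖) := by
    have := measurable_symbolJ0 σ t
    fun_prop
  have h := eLpNorm_triangle_real hmeas.norm.aestronglyMeasurable hQm.1 hGm.1 hδ.le hA
    (mul_nonneg hK (Real.exp_pos (-(minRate σ * t))).le) (by positivity) (by positivity)
    ENNReal.toReal_nonneg (F := L * B n t) (by rw [eLpNorm_norm]; exact hL t ht) hQ
    (ENNReal.ofReal_toReal hGm.2.ne).ge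
  rw [hprof, eLpNorm_sub_fourierInv (u t) (hdec.integrable hn) (hdec.memLp_two hn)]
  have h2 := (eLpNorm_mono_ae_real (p := 2) (g := fun x ↦
      δ * ‖2 * Real.pi * ‖x‖ * symbolJ0 σ t (2 * Real.pi * ‖x‖)‖
        + A * (‖x‖ ^ (0 : ℝ) * Real.exp (-(minRate σ * t * ‖x‖ ^ 4)))
        + K * Real.exp (-(minRate σ * t)) * G x) (by
    filter_upwards [hAK t ht0] with x hx
    simpa only [Real.rpow_zero, one_mul] using hx)).trans h
  refine (ENNReal.toReal_mono ENNReal.ofReal_ne_top h2).trans ?_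
  rw [ENNReal.toReal_ofReal (by positivity)]
  refine le_of_eq ?_
  simp only [mul_zero, add_zero, neg_mul]
  ring

lemma isLittleO_rpow_of_lt {p q : ℝ} (h : p < q) :
    (fun t : ℝ ↦ t ^ p) =o[atTop] fun t : ℝ ↦ t ^ q := by
  have h0 : (fun t : ℝ ↦ t ^ (-(q - p))) =o[atTop] fun _ : ℝ ↦ (1 : ℝ) :=
    (isLittleO_one_iff ℝ).2 (tendsto_rpow_neg_atTop (sub_pos.2 h))
  refine (h0.mul_isBigO (isBigO_refl (fun t : ℝ ↦ t ^ q) atTop)).congr' ?_ ?_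
  · filter_upwards [eventually_gt_atTop 0] with t ht
    rw [← Real.rpow_add ht]
    congr 1; ring
  · exact Eventually.of_forall fun t ↦ one_mul _

lemma isLittleO_rpow_B (hn : 1 ≤ n) : (fun t : ℝ ↦ t ^ (-(n : ℝ) / 8)) =o[atTop] B n := by
  rcases (show n = 1 ∨ n = 2 ∨ 3 ≤ n by omega) with rfl | rfl | h
  · have : B 1 = fun t : ℝ ↦ t ^ (1 / 4 : ℝ) := by funext t; simp [B]
    rw [this]
    exact isLittleO_rpow_of_lt (by norm_num)
  · have : B 2 = fun t : ℝ ↦ Real.sqrt (Real.log t) := by funext t; simp [B]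
    rw [this]
    have h1 : (fun t : ℝ ↦ t ^ (-((2 : ℕ) : ℝ) / 8)) =o[atTop] fun _ : ℝ ↦ (1 : ℝ) := by
      rw [isLittleO_one_iff]
      have := tendsto_rpow_neg_atTop (y := 1 / 4) (by norm_num)
      refine this.congr fun t ↦ ?_
      norm_num
    refine h1.trans_isBigO (IsBigO.of_bound 1 ?_)
    filter_upwards [eventually_ge_atTop (Real.exp 1)] with t ht
    have h2 : 1 ≤ Real.log t := by
      rw [Real.le_log_iff_exp_le ((Real.exp_pos 1).trans_le ht)]; exact ht
    rw [one_mul, norm_one, Real.norm_eq_abs, abs_of_nonneg (Real.sqrt_nonneg _)]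
    exact Real.one_le_sqrt.2 h2
  · have : B n = fun t : ℝ ↦ t ^ (1 / 4 - (n : ℝ) / 8) := by
      funext t; rw [B, if_neg (by omega), if_neg (by omega)]
    rw [this]
    exact isLittleO_rpow_of_lt (by linarith)

end ThermoPlate

theorem theorem2p2 (n : ℕ) (hn : 1 ≤ n) (σ : ℝ) (hσ : 0 < σ)
    (u₀ u₁ θ₀ : ThermoPlate.L2 n)
    (hu₀ : ThermoPlate.MemL11 u₀) (hu₁ : ThermoPlate.MemL11 u₁) (hθ₀ : ThermoPlate.MemL11 θ₀)
    (u : ℝ → ThermoPlate.L2 n) (θ : ℝ → 𝓢'(ThermoPlate.E n, ℂ))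
    (hsol : ThermoPlate.IsSolution σ u₀ u₁ θ₀ u θ) :
    (∀ t, 0 < t → MemLp (ThermoPlate.profile σ u₀ u₁ θ₀ t) 2) ∧
    (fun t : ℝ ↦ (eLpNorm (fun x ↦ u t x - ThermoPlate.profile σ u₀ u₁ θ₀ t x) 2).toReal)
      =o[atTop] (ThermoPlate.B n) ∧
    (3 ≤ n → Tendsto (fun t : ℝ ↦
      (eLpNorm (fun x ↦ u t x - ThermoPlate.profile σ u₀ u₁ θ₀ t x) 2).toReal) atTop (𝓝 0)) := by
  have hlo : (fun t : ℝ ↦ (eLpNorm (fun x ↦ u t x - ThermoPlate.profile σ u₀ u₁ θ₀ t x) 2).toReal)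
      =o[atTop] (ThermoPlate.B n) := by
    obtain ⟨L, hL0, hL⟩ := ThermoPlate.exists_norm_bound hn hσ hu₀ hu₁ hθ₀ hsol
    rw [isLittleO_iff]
    intro c hc
    -- This `δ` makes `δL ≤ c/2`; the `+ 1` covers `L = 0`. The other half of `c` goes to the
    -- remaining terms.
    obtain ⟨A, K, hAK⟩ := hL (c / (2 * (L + 1))) (by positivity)
    have h1 := (isLittleO_exp_neg_mul_rpow_atTop (ThermoPlate.minRate_pos hσ) (-(n : ℝ) / 8)).trans
      (ThermoPlate.isLittleO_rpow_B hn)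
    have h2 := (((ThermoPlate.isLittleO_rpow_B hn).const_mul_left A).add
      (h1.const_mul_left K)).def (half_pos hc)
    filter_upwards [h2, eventually_ge_atTop 2] with t ht ht2
    have hB := ThermoPlate.B_nonneg n (show 0 ≤ t by linarith)
    rw [Real.norm_eq_abs, Real.norm_eq_abs, abs_of_nonneg hB] at ht
    rw [Real.norm_eq_abs, abs_of_nonneg ENNReal.toReal_nonneg, Real.norm_eq_abs, abs_of_nonneg hB]
    have h3 : c / (2 * (L + 1)) * (L * ThermoPlate.B n t) ≤ c / 2 * ThermoPlate.B n t := by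
      rw [← mul_assoc]
      gcongr
      rw [div_mul_eq_mul_div, div_le_iff₀ (by positivity)]
      nlinarith
    have h4 := hAK t ht2
    have h5 := (le_abs_self _).trans ht
    linarith
  refine ⟨fun t ht ↦ ?_, hlo, fun h3 ↦ hlo.trans_tendsto ?_⟩
  · obtain ⟨hdec, hprof⟩ := ThermoPlate.profileSymbol_spec hσ ht hn u₀ u₁ θ₀
    rw [hprof]
    exact ThermoPlate.memLp_fourierInv (hdec.integrable hn) (hdec.memLp_two hn)
  · have h3' : (3 : ℝ) ≤ n := by exact_mod_cast h3
    refine (tendsto_rpow_neg_atTop (y := (n : ℝ) / 8 - 1 / 4) (by linarith)).congr fun t ↦ ?_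
    rw [ThermoPlate.B, if_neg (by omega), if_neg (by omega)]
    congr 1; ring
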